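/- Let $N\in\{1,2,3\}$, let $m$ be a natural number, and let $\Omega\subset\mathbb{R}^N$ be a bounded domain (a nonempty, bounded, connected open set; no regularity of $\partial\Omega$ is required). Let $\varepsilon_1,\dots,\varepsilon_m>0$, and let $H=H_0^1(\Omega,\mathbb{R}^m)$, where $H_0^1(\Omega)$ is the closure of $C_c^\infty(\Omega)$ in $H^1(\Omega)$, be equipped with the inner product $$(\mathbf u,\mathbf v)_H=\int_\Omega\sum_{i=1}^m\varepsilon_i\nabla u_i\cdot\nabla v_i\,d\mathbf x,\qquad \|\mathbf u\|_H=\sqrt{(\mathbf u,\mathbf u)_H},$$ which makes $H$ a Hilbert space. Assume that - $\mathbf g=(g_{ij})\in\mathbb{R}^{m\times m}$ is symmetric, and either $g_{ij}>0$ for all $i,j$, or $\mathbf g$ is positive definite; - $a_i\in L^\infty(\Omega)$ and $a_i(\mathbf x)>-\lambda_1$ for a.e. $\mathbf x\in\Omega$, for each $i=1,\dots,m$, where $\lambda_1>0$ is the first Dirichlet eigenvalue of $-\Delta$ in $\Omega$. Define $E:H\to\mathbb{R}$ by $$E(\mathbf u)=\frac12\int_\Omega\sum_{i=1}^m\left(\varepsilon_i|\nabla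 u_i|^2+a_i|u_i|^2\right)d\mathbf x-\frac14\int_\Omega\sum_{i,j=1}^m g_{ij}|u_i|^2|u_j|^2\,d\mathbf x,$$ let $E'(\mathbf u)$ denote its Fréchet derivative, and set $$G(\mathbf u)=\langle E'(\mathbf u),\mathbf u\rangle,\qquad \mathcal N=\{\mathbf u\in H\setminus\{0\}: G(\mathbf u)=0\},\qquad T_{\mathbf u}\mathcal N=\{\boldsymbol\xi\in H:\langle G'(\mathbf u),\boldsymbol\xi\rangle=0\}\quad(\mathbf u\in\mathcal N).$$ For $\mathbf u\in\mathcal N$ let the Riemannian gradient $\nabla_{\mathcal N}E(\mathbf u)$ be the unique element of $T_{\mathbf u}\mathcal N$ such that $(\nabla_{\mathcal N}E(\mathbf u),\boldsymbol\xi)_H=\langle E'(\mathbf u),\boldsymbol\xi\rangle$ for all $\boldsymbol\xi\in T_{\mathbf u}\mathcal N$. Then $E$ satisfies the Palais–Smale condition on $\mathcal N$: every sequence $\{\mathbf u_n\}\subset\mathcal N$ such that $\{E(\mathbf u_n)\}$ is bounded and $\|\nabla_{\mathcal N}E(\mathbf u_n)\|_H\to0$ as $n\to\infty$ has a subsequence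 that converges in $H$. -/

import Mathlib

open MeasureTheory Filter Topology Set
open scoped ENNReal Distributions InnerProductSpace Gradient

noncomputable section

/-- A bounded domain in `ℝᴺ`: a nonempty, connected, bounded open set. -/
structure BoundedDomain (N : ℕ) extends TopologicalSpace.Opens (EuclideanSpace ℝ (Fin N)) where
  isConnected : IsConnected carrier
  isBounded : Bornology.IsBounded carrier

namespace BoundedDomain

variable {N : ℕ}

/-- Lebesgue measure on `Ω`. -/
abbrev measure (Ω : BoundedDomain N) : Measure (EuclideanSpace ℝ (Fin N)) :=
  volume.restrict Ω.carrier

/-- `L²(Ω) × L²(Ω; ℝᴺ)`. A function of `H¹(Ω)` is represented by the pair of the function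
and its weak gradient. -/
abbrev L2Pair (Ω : BoundedDomain N) : Type :=
  Lp ℝ 2 Ω.measure × Lp (EuclideanSpace ℝ (Fin N)) 2 Ω.measure

/-- The pairs `(φ, ∇φ)` with `φ ∈ C_c^∞(Ω)`. -/
def testPairs (Ω : BoundedDomain N) : Submodule ℝ Ω.L2Pair where
  carrier := {p | ∃ φ : 𝓓(Ω.toOpens, ℝ), p.1 =ᵐ[Ω.measure] φ ∧ p.2 =ᵐ[Ω.measure] ∇ φ}
  zero_mem' := by
    refine ⟨0, Lp.coeFn_zero _ _ _, (Lp.coeFn_zero _ _ _).trans (.of_forall fun x => ?_)⟩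
    have : ((0 : 𝓓(Ω.toOpens, ℝ)) : EuclideanSpace ℝ (Fin N) → ℝ) = fun _ => 0 := rfl
    rw [this, gradient_fun_const]
    rfl
  add_mem' := by
    rintro p q ⟨φ, h1, h2⟩ ⟨ψ, h3, h4⟩
    refine ⟨φ + ψ, ?_, ?_⟩
    · filter_upwards [Lp.coeFn_add p.1 q.1, h1, h3] with x hx h1 h3
      rw [Prod.fst_add, hx, Pi.add_apply, h1, h3]; rfl
    · filter_upwards [Lp.coeFn_add p.2 q.2, h2, h4] with x hx h2 h4
      rw [Prod.snd_add, hx, Pi.add_apply, h2, h4]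
      have hφ : DifferentiableAt ℝ φ x := (φ.contDiff.differentiable (by simp)) x
      have hψ : DifferentiableAt ℝ ψ x := (ψ.contDiff.differentiable (by simp)) x
      have : ((φ + ψ : 𝓓(Ω.toOpens, ℝ)) : EuclideanSpace ℝ (Fin N) → ℝ) = ⇑φ + ⇑ψ := rfl
      rw [gradient, gradient, gradient, this, fderiv_add hφ hψ, map_add]
  smul_mem' := by
    rintro c p ⟨φ, h1, h2⟩
    refine ⟨c • φ, ?_, ?_⟩
    · filter_upwards [Lp.coeFn_smul c p.1, h1] with x hx h1
      rw [Prod.smul_fst, hx, Pi.smul_apply, h1]; rfl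
    · filter_upwards [Lp.coeFn_smul c p.2, h2] with x hx h2
      rw [Prod.smul_snd, hx, Pi.smul_apply, h2]
      have hφ : DifferentiableAt ℝ φ x := (φ.contDiff.differentiable (by simp)) x
      have : ((c • φ : 𝓓(Ω.toOpens, ℝ)) : EuclideanSpace ℝ (Fin N) → ℝ) = c • ⇑φ := rfl
      rw [gradient, gradient, this, fderiv_const_smul hφ, map_smulₛₗ]
      simp

/-- `H₀¹(Ω)`: the closure of `C_c^∞(Ω)` in the `H¹` topology, each element being represented by
the pair `(u, ∇u)` of its class in `L²(Ω)` and its weak gradient in `L²(Ω; ℝᴺ)`. -/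
def H01 (Ω : BoundedDomain N) : Submodule ℝ Ω.L2Pair := Ω.testPairs.topologicalClosure

/-- The function underlying an element of `H₀¹(Ω)`. -/
abbrev H01.val {Ω : BoundedDomain N} (u : Ω.H01) : Lp ℝ 2 Ω.measure := u.1.1

/-- The weak gradient of an element of `H₀¹(Ω)`. -/
abbrev H01.grad {Ω : BoundedDomain N} (u : Ω.H01) :
    Lp (EuclideanSpace ℝ (Fin N)) 2 Ω.measure := u.1.2

/-- `lam` is an eigenvalue of `-Δ` on `Ω` with homogeneous Dirichlet boundary condition (in the
weak sense). -/
def IsDirichletEigenvalue (Ω : BoundedDomain N) (lam : ℝ) : Prop :=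
  ∃ u : Ω.H01, u ≠ 0 ∧ ∀ v : Ω.H01,
    ∫ x, inner ℝ (H01.grad u x) (H01.grad v x) ∂Ω.measure =
      lam * ∫ x, H01.val u x * H01.val v x ∂Ω.measure

/-- The first Dirichlet eigenvalue `λ₁` of `-Δ` on `Ω`. -/
def firstDirichletEigenvalue (Ω : BoundedDomain N) : ℝ :=
  sInf {lam | Ω.IsDirichletEigenvalue lam}

/-- Poincaré inequality for compactly supported `C¹` functions. -/
theorem poincare_test [NeZero N] {R : ℝ} (φ : EuclideanSpace ℝ (Fin N) → ℝ)
    (hcd : ContDiff ℝ 1 φ) (hsupp : HasCompactSupport φ) (hR : ∀ x, φ x ≠ 0 → ‖x‖ ≤ R) :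
    ∫ x, φ x ^ 2 ≤ 4 * R ^ 2 * ∫ x, ‖∇ φ x‖ ^ 2 := by
  have hd : Differentiable ℝ φ := hcd.differentiable (by simp)
  have hc : Continuous φ := hcd.continuous
  have hcf : Continuous (fderiv ℝ φ) := hcd.continuous_fderiv (by simp)
  have hcg : Continuous (∇ φ) := (InnerProductSpace.toDual ℝ _).symm.continuous.comp hcf
  have hsg : HasCompactSupport (∇ φ) :=
    (hsupp.fderiv ℝ).comp_left (g := (InnerProductSpace.toDual ℝ _).symm) (map_zero _)
  obtain ⟨e, hne⟩ : ∃ e : EuclideanSpace ℝ (Fin N), ‖e‖ = 1 :=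
    ⟨EuclideanSpace.single 0 1, by simp⟩
  obtain ⟨L, hL⟩ : ∃ L : EuclideanSpace ℝ (Fin N) →L[ℝ] ℝ, ∀ x, L x = inner ℝ e x :=
    ⟨innerSL ℝ e, fun x => rfl⟩
  have hLe : L e = 1 := by rw [hL, real_inner_self_eq_norm_sq, hne]; norm_num
  have hfsq : ∀ x, fderiv ℝ (fun y => φ y ^ 2) x e = 2 * φ x * inner ℝ (∇ φ x) e := by
    intro x
    have h := ((hd x).hasFDerivAt.pow 2).fderiv
    rw [h, inner_gradient_left]
    simp [mul_assoc]
  have hcs2 : HasCompactSupport (fun x => φ x ^ 2) :=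
    hsupp.comp_left (g := fun t : ℝ => t ^ 2) (by simp)
  have hparts : ∫ x, φ x ^ 2 * fderiv ℝ L x e
      = - ∫ x, fderiv ℝ (fun y => φ y ^ 2) x e * L x := by
    apply integral_mul_fderiv_eq_neg_fderiv_mul_of_integrable
    · apply Continuous.integrable_of_hasCompactSupport
      · simp only [hfsq]; fun_prop
      · refine HasCompactSupport.mul_right ?_
        simp only [hfsq]
        exact HasCompactSupport.mul_right (hsupp.mul_left (f := fun _ => (2 : ℝ)))
    · simp only [ContinuousLinearMap.fderiv, hLe, mul_one]
      exact (hc.pow 2).integrable_of_hasCompactSupport hcs2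
    · exact ((hc.pow 2).mul L.continuous).integrable_of_hasCompactSupport hcs2.mul_right
    · exact fun x _ => (hd x).pow 2
    · exact fun x _ => L.differentiableAt
  simp only [ContinuousLinearMap.fderiv, hLe, mul_one, hfsq] at hparts
  have hi1 : Integrable fun x => φ x ^ 2 :=
    (hc.pow 2).integrable_of_hasCompactSupport hcs2
  have hsg2 : HasCompactSupport fun x => ‖∇ φ x‖ ^ 2 :=
    hsg.comp_left (g := fun v : EuclideanSpace ℝ (Fin N) => ‖v‖ ^ 2) (by simp)
  have hcg2 : Continuous fun x => ‖∇ φ x‖ ^ 2 := by fun_prop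
  have hi2 : Integrable fun x => ‖∇ φ x‖ ^ 2 := hcg2.integrable_of_hasCompactSupport hsg2
  have hbound : ∫ x, φ x ^ 2 ≤ ∫ x, (φ x ^ 2 / 2 + 2 * R ^ 2 * ‖∇ φ x‖ ^ 2) := by
    rw [hparts, ← integral_neg]
    refine integral_mono ?_ ((hi1.div_const 2).add (hi2.const_mul _)) fun x => ?_
    · refine (Continuous.integrable_of_hasCompactSupport (by fun_prop) ?_).neg
      exact ((hsupp.mul_left (f := fun _ => (2 : ℝ))).mul_right).mul_right
    · dsimp only
      by_cases hx : φ x = 0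
      · simp only [hx]; simp; positivity
      · have hxR : ‖x‖ ≤ R := hR x hx
        have hR0 : 0 ≤ R := (norm_nonneg x).trans hxR
        have h1 : |inner ℝ (∇ φ x) e| ≤ ‖∇ φ x‖ := by
          simpa [hne] using abs_real_inner_le_norm (∇ φ x) e
        have h2 : |L x| ≤ R := by
          rw [hL]
          refine (abs_real_inner_le_norm e x).trans ?_
          simpa [hne] using hxR
        have h3 : -(2 * φ x * inner ℝ (∇ φ x) e * L x) ≤ 2 * |φ x| * (‖∇ φ x‖ * R) := by
          refine (neg_le_abs _).trans ?_
          rw [mul_assoc, abs_mul, abs_mul, abs_mul, abs_two]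
          gcongr
        refine h3.trans ?_
        nlinarith [sq_nonneg (|φ x| - 2 * (‖∇ φ x‖ * R)), sq_abs (φ x)]
  rw [integral_add (hi1.div_const 2) (hi2.const_mul _), integral_div, integral_const_mul] at hbound
  linarith

/-- Poincaré inequality in `H₀¹(Ω)`. -/
theorem exists_poincare [NeZero N] (Ω : BoundedDomain N) :
    ∃ C : ℝ, 0 ≤ C ∧ ∀ u : Ω.H01, ‖H01.val u‖ ≤ C * ‖H01.grad u‖ := by
  obtain ⟨R, hR0, hR⟩ := Ω.isBounded.exists_pos_norm_le
  refine ⟨2 * R, by positivity, fun u => ?_⟩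
  have hclosed : IsClosed {p : Ω.L2Pair | ‖p.1‖ ≤ 2 * R * ‖p.2‖} :=
    isClosed_le (by fun_prop) (by fun_prop)
  have hsub : (Ω.testPairs : Set Ω.L2Pair) ⊆ {p : Ω.L2Pair | ‖p.1‖ ≤ 2 * R * ‖p.2‖} := by
    rintro p ⟨φ, h1, h2⟩
    have hz : ∀ x ∉ Ω.carrier, x ∉ tsupport φ := fun x hx h => hx (φ.tsupport_subset h)
    have e1 : ‖p.1‖ ^ 2 = ∫ x, φ x ^ 2 := by
      have h0 : ∫ x in Ω.carrier, φ x ^ 2 = ∫ x, φ x ^ 2 :=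
        setIntegral_eq_integral_of_forall_compl_eq_zero fun x hx => by
          rw [image_eq_zero_of_notMem_tsupport (hz x hx)]; simp
      rw [← real_inner_self_eq_norm_sq, L2.inner_def, ← h0]
      refine integral_congr_ae ?_
      filter_upwards [h1] with x hx
      rw [hx, real_inner_self_eq_norm_sq, Real.norm_eq_abs, sq_abs]
    have e2 : ‖p.2‖ ^ 2 = ∫ x, ‖∇ φ x‖ ^ 2 := by
      have h0 : ∫ x in Ω.carrier, ‖∇ φ x‖ ^ 2 = ∫ x, ‖∇ φ x‖ ^ 2 :=
        setIntegral_eq_integral_of_forall_compl_eq_zero fun x hx => by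
          have : fderiv ℝ (φ : EuclideanSpace ℝ (Fin N) → ℝ) x = 0 := by
            refine image_eq_zero_of_notMem_tsupport
              (f := fderiv ℝ (φ : EuclideanSpace ℝ (Fin N) → ℝ)) fun h => hz x hx ?_
            exact (tsupport_fderiv_subset ℝ (f := ⇑φ)) h
          simp only [gradient, this, map_zero, norm_zero]; norm_num
      rw [← real_inner_self_eq_norm_sq, L2.inner_def, ← h0]
      refine integral_congr_ae ?_
      filter_upwards [h2] with x hx
      rw [hx, real_inner_self_eq_norm_sq]
    have := poincare_test φ (φ.contDiff.of_le (by simp)) φ.hasCompactSupport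
      fun x hx => hR x (φ.tsupport_subset (subset_tsupport _ hx))
    rw [← e1, ← e2] at this
    change ‖p.1‖ ≤ 2 * R * ‖p.2‖
    refine (abs_le_of_sq_le_sq' (this.trans_eq ?_) (by positivity)).2
    ring
  exact closure_minimal hsub hclosed u.2

end BoundedDomain

open BoundedDomain

variable {N m : ℕ}

/-- The Sobolev space `H = H₀¹(Ω; ℝᵐ)`, to be equipped with the inner product
`(u, v)_H = ∫_Ω ∑ᵢ εᵢ ∇uᵢ · ∇vᵢ`, where `εᵢ > 0`. -/
def SystemSpace (Ω : BoundedDomain N) (_ε : Fin m → Ioi (0 : ℝ)) : Type :=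
  Fin m → Ω.H01

namespace SystemSpace

variable {Ω : BoundedDomain N} {ε : Fin m → Ioi (0 : ℝ)}

instance : AddCommGroup (SystemSpace Ω ε) := inferInstanceAs (AddCommGroup (Fin m → Ω.H01))

instance : Module ℝ (SystemSpace Ω ε) := inferInstanceAs (Module ℝ (Fin m → Ω.H01))

/-- The `i`-th component `uᵢ` of `u`. -/
def comp (u : SystemSpace Ω ε) (i : Fin m) : Lp ℝ 2 Ω.measure := H01.val (u i)

/-- The weak gradient `∇uᵢ` of the `i`-th component of `u`. -/
def grad (u : SystemSpace Ω ε) (i : Fin m) : Lp (EuclideanSpace ℝ (Fin N)) 2 Ω.measure :=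
  H01.grad (u i)

/-- The inner product `(u, v)_H = ∫_Ω ∑ᵢ εᵢ ∇uᵢ · ∇vᵢ`. -/
def innerH (u v : SystemSpace Ω ε) : ℝ :=
  ∫ x, ∑ i, (ε i : ℝ) * inner ℝ (u.grad i x) (v.grad i x) ∂Ω.measure

theorem innerH_eq_sum (u v : SystemSpace Ω ε) :
    innerH u v = ∑ i, (ε i : ℝ) * inner ℝ (u.grad i) (v.grad i) := by
  rw [innerH, integral_finsetSum _ fun i _ => (L2.integrable_inner _ _).const_mul _]
  simp only [integral_const_mul, L2.inner_def]

/-- `(·, ·)_H` is an inner product; it is definite by the Poincaré inequality. -/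
@[reducible] def innerCore [NeZero N] : InnerProductSpace.Core ℝ (SystemSpace Ω ε) where
  inner := innerH
  conj_inner_symm u v := by
    simp only [innerH_eq_sum, conj_trivial]
    exact Finset.sum_congr rfl fun i _ => by rw [real_inner_comm]
  re_inner_nonneg u := by
    simp only [innerH_eq_sum, RCLike.re_to_real]
    exact Finset.sum_nonneg fun i _ => mul_nonneg (ε i).2.le real_inner_self_nonneg
  add_left u v w := by
    simp only [innerH_eq_sum, ← Finset.sum_add_distrib, ← mul_add, ← inner_add_left]
    rfl
  smul_left u v r := by
    have : ∀ i, (r • u).grad i = r • u.grad i := fun i => rfl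
    simp only [innerH_eq_sum, Finset.mul_sum, this, real_inner_smul_left, conj_trivial]
    exact Finset.sum_congr rfl fun i _ => by ring
  definite u hu := by
    obtain ⟨C, -, hC⟩ := exists_poincare Ω
    rw [innerH_eq_sum, Finset.sum_eq_zero_iff_of_nonneg
      fun i _ => mul_nonneg (ε i).2.le real_inner_self_nonneg] at hu
    funext i
    have hg : H01.grad (u i) = 0 := by
      have := (mul_eq_zero.1 (hu i (Finset.mem_univ i))).resolve_left (ne_of_gt (ε i).2)
      exact inner_self_eq_zero.1 this
    have hv : H01.val (u i) = 0 := by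
      have := hC (u i)
      rw [hg, norm_zero, mul_zero] at this
      exact norm_le_zero_iff.1 this
    exact Subtype.ext (Prod.ext hv hg)

instance [NeZero N] : NormedAddCommGroup (SystemSpace Ω ε) :=
  InnerProductSpace.Core.toNormedAddCommGroup (cd := innerCore)

instance [NeZero N] : InnerProductSpace ℝ (SystemSpace Ω ε) :=
  InnerProductSpace.ofCore innerCore.toCore

theorem inner_def [NeZero N] (u v : SystemSpace Ω ε) :
    inner ℝ u v = ∫ x, ∑ i, (ε i : ℝ) * inner ℝ (u.grad i x) (v.grad i x) ∂Ω.measure := rfl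

theorem norm_sq_eq [NeZero N] (u : SystemSpace Ω ε) :
    ‖u‖ ^ 2 = ∑ i, (ε i : ℝ) * ‖u.grad i‖ ^ 2 := by
  rw [← real_inner_self_eq_norm_sq, inner_def, ← innerH, innerH_eq_sum]
  simp only [real_inner_self_eq_norm_sq]

/-- The `H`-norm is equivalent to the product of the `H¹` norms. -/
theorem exists_equiv_prod [NeZero N] (Ω : BoundedDomain N) (ε : Fin m → Ioi (0 : ℝ)) :
    ∃ e : SystemSpace Ω ε ≃L[ℝ] (Fin m → Ω.H01), ∀ u i, e u i = u i := by
  let e : SystemSpace Ω ε ≃ₗ[ℝ] (Fin m → Ω.H01) := LinearEquiv.refl ℝ _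
  obtain ⟨C, hC0, hC⟩ := exists_poincare Ω
  set S : ℝ := ∑ i, (√(ε i : ℝ))⁻¹ with hS
  set T : ℝ := ∑ i, (ε i : ℝ) with hT
  have hS0 : 0 ≤ S := Finset.sum_nonneg fun i _ => by positivity
  have hgrad : ∀ (u : SystemSpace Ω ε) i, ‖u.grad i‖ ≤ S * ‖u‖ := by
    intro u i
    have hpos : 0 < √(ε i : ℝ) := Real.sqrt_pos.2 (ε i).2
    have h1 : (√(ε i : ℝ) * ‖u.grad i‖) ^ 2 ≤ ‖u‖ ^ 2 := by
      rw [norm_sq_eq, mul_pow, Real.sq_sqrt (ε i).2.le]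
      exact Finset.single_le_sum (f := fun i => (ε i : ℝ) * ‖u.grad i‖ ^ 2)
        (fun i _ => mul_nonneg (ε i).2.le (sq_nonneg _)) (Finset.mem_univ i)
    have h2 : √(ε i : ℝ) * ‖u.grad i‖ ≤ ‖u‖ :=
      (abs_le_of_sq_le_sq' h1 (norm_nonneg _)).2
    have h3 : (√(ε i : ℝ))⁻¹ ≤ S :=
      Finset.single_le_sum (f := fun i => (√(ε i : ℝ))⁻¹) (fun i _ => by positivity)
        (Finset.mem_univ i)
    calc ‖u.grad i‖ = (√(ε i : ℝ))⁻¹ * (√(ε i : ℝ) * ‖u.grad i‖) := by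
          field_simp
      _ ≤ S * ‖u‖ := by gcongr
  refine ⟨e.toContinuousLinearEquivOfBounds (max C 1 * S) (√T) (fun u => ?_) (fun u => ?_),
    fun u i => rfl⟩
  · refine (pi_norm_le_iff_of_nonneg (by positivity)).2 fun i => ?_
    have h1 := hgrad u i
    have h2 := hC (u i)
    change max ‖H01.val (u i)‖ ‖H01.grad (u i)‖ ≤ _
    change ‖H01.grad (u i)‖ ≤ _ at h1
    have h4 : 0 ≤ ‖H01.grad (u i)‖ := norm_nonneg _
    have h5 : max C 1 * ‖H01.grad (u i)‖ ≤ max C 1 * S * ‖u‖ := by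
      rw [mul_assoc]; gcongr
    refine max_le ((h2.trans ?_).trans h5) (le_trans ?_ h5)
    · gcongr; exact le_max_left _ _
    · exact le_mul_of_one_le_left h4 (le_max_right _ _)
  · have hT0 : 0 ≤ T := Finset.sum_nonneg fun i _ => (ε i).2.le
    refine (abs_le_of_sq_le_sq' ?_ (by positivity)).2
    rw [norm_sq_eq, mul_pow, Real.sq_sqrt hT0, hT, Finset.sum_mul]
    refine Finset.sum_le_sum fun i _ => mul_le_mul_of_nonneg_left ?_ (ε i).2.le
    have h1 : ‖H01.grad (u i)‖ ≤ ‖u i‖ := le_max_right ‖(u i).1.1‖ ‖(u i).1.2‖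
    have h2 := h1.trans (norm_le_pi_norm u i)
    change ‖H01.grad (u i)‖ ^ 2 ≤ _
    gcongr

instance [NeZero N] : CompleteSpace (SystemSpace Ω ε) := by
  obtain ⟨e, -⟩ := exists_equiv_prod Ω ε
  have hcl : IsClosed ((Ω.H01 : Submodule ℝ Ω.L2Pair) : Set Ω.L2Pair) :=
    Submodule.isClosed_topologicalClosure _
  have : CompleteSpace Ω.H01 := hcl.completeSpace_coe
  exact (completeSpace_congr (e := e.toEquiv) e.isUniformEmbedding).2 inferInstance

/-- The energy functional
`E(u) = ½ ∫_Ω ∑ᵢ (εᵢ |∇uᵢ|² + aᵢ |uᵢ|²) - ¼ ∫_Ω ∑ᵢⱼ gᵢⱼ |uᵢ|² |uⱼ|²`. -/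
def energy (a : Fin m → EuclideanSpace ℝ (Fin N) → ℝ) (g : Matrix (Fin m) (Fin m) ℝ)
    (u : SystemSpace Ω ε) : ℝ :=
  1 / 2 * ∫ x, ∑ i, ((ε i : ℝ) * ‖u.grad i x‖ ^ 2 + a i x * |u.comp i x| ^ 2) ∂Ω.measure
    - 1 / 4 * ∫ x, ∑ i, ∑ j, g i j * |u.comp i x| ^ 2 * |u.comp j x| ^ 2 ∂Ω.measure

variable [NeZero N]

/-- The Nehari functional `G(u) = ⟨E'(u), u⟩` of a functional `E : H → ℝ`. -/
def nehariFunctional (E : SystemSpace Ω ε → ℝ) (u : SystemSpace Ω ε) : ℝ :=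
  fderiv ℝ E u u

/-- The Nehari manifold `{u ∈ H \ {0} : ⟨E'(u), u⟩ = 0}` of `E`. -/
def nehariManifold (E : SystemSpace Ω ε → ℝ) : Set (SystemSpace Ω ε) :=
  {u | u ≠ 0 ∧ fderiv ℝ E u u = 0}

/-- The tangent space `{ξ ∈ H : ⟨G'(u), ξ⟩ = 0}` of the Nehari manifold at `u`. -/
abbrev nehariTangent (E : SystemSpace Ω ε → ℝ) (u : SystemSpace Ω ε) :
    Submodule ℝ (SystemSpace Ω ε) :=
  (fderiv ℝ (nehariFunctional E) u).ker

/-- The Riemannian gradient of `E` on the Nehari manifold at `u`: the Riesz representer, in the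
tangent space with the inner product `(·, ·)_H`, of the restriction of `E'(u)` to it. -/
def riemannianGradient (E : SystemSpace Ω ε → ℝ) (u : SystemSpace Ω ε) : nehariTangent E u :=
  (InnerProductSpace.toDual ℝ (nehariTangent E u)).symm
    ((fderiv ℝ E u).comp (nehariTangent E u).subtypeL)

/-- The property that characterizes the Riemannian gradient. -/
theorem inner_riemannianGradient (E : SystemSpace Ω ε → ℝ) (u : SystemSpace Ω ε)
    (ξ : SystemSpace Ω ε) (hξ : ξ ∈ nehariTangent E u) :
    inner ℝ (riemannianGradient E u : SystemSpace Ω ε) ξ = fderiv ℝ E u ξ := by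
  have h := InnerProductSpace.toDual_symm_apply (𝕜 := ℝ)
    (x := (⟨ξ, hξ⟩ : nehariTangent E u))
    (y := (fderiv ℝ E u).comp (nehariTangent E u).subtypeL)
  exact h

end SystemSpace

end

/-!
Where `⟨E'(u), u⟩ = 0` the quartic term of the energy equals `4 E(u)`, so it is bounded along a
Palais–Smale sequence. By copositivity of the coupling matrix it controls the `L⁴` norm, and the
constraint then bounds the `H` norm. All terms of `E` other than `½‖u‖²` factor through the
embedding of `H₀¹(Ω)` in `L⁴(Ω)`, which is compact for `N ≤ 3`, so along a subsequence `uₙ`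
converges in `L⁴`. If the limit is zero, the constraint gives `uₙ → 0` in `H`. Otherwise
`⟨G'(uₙ), uₙ⟩`, on the constraint a negative multiple of the quartic term, stays away from zero;
pairing the constrained gradient with `uₙ` shows that the Lagrange multiplier tends to zero. Hence
`E'(uₙ) → 0`, and `uₙ` converges in `H` because its image in `L⁴` does.

Compactness of the embedding uses no regularity of the boundary. Averages over small balls around
finitely many points are finite-rank operators that approximate the embedding in `L²` in operator
norm, and interpolation with the Sobolev bound in `L⁶` carries compactness from `L²` to `L⁴`.
-/

noncomputable section

section AbstractPalaisSmale

theorem fderiv_apply_self_of_homogeneous {X : Type*} [NormedAddCommGroup X] [NormedSpace ℝ X]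
    {Q : X → ℝ} {p : ℝ} {x : X} (hhom : ∀ t : ℝ, 0 < t → Q (t • x) = t ^ p * Q x)
    (hQ : DifferentiableAt ℝ Q x) : fderiv ℝ Q x x = p * Q x := by
  have hray : HasDerivAt (fun t : ℝ => t • x) x 1 := by
    simpa using (hasDerivAt_id (1 : ℝ)).smul_const x
  have hleft : HasDerivAt (fun t : ℝ => Q (t • x)) (fderiv ℝ Q x x) 1 := by
    refine HasFDerivAt.comp_hasDerivAt 1 ?_ hray
    simpa using hQ.hasFDerivAt
  have hright : HasDerivAt (fun t : ℝ => t ^ p * Q x) (p * Q x) 1 := by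
    simpa using (Real.hasDerivAt_rpow_const (p := p) (Or.inl one_ne_zero)).mul_const (Q x)
  have hevent : (fun t : ℝ => Q (t • x)) =ᶠ[𝓝 1] fun t => t ^ p * Q x := by
    filter_upwards [lt_mem_nhds zero_lt_one] with t ht using hhom t ht
  exact (hleft.congr_of_eventuallyEq hevent.symm).unique hright

section Multiplier

variable {H : Type*} [NormedAddCommGroup H] [NormedSpace ℝ H]

theorem eq_sub_smul_of_eqOn_ker {e γ r : H →L[ℝ] ℝ} {u : H} (hγ : γ u ≠ 0) (heu : e u = 0)
    (h : ∀ ξ, γ ξ = 0 → r ξ = e ξ) : e = r - (r u / γ u) • γ := by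
  ext ξ
  have hproj := h (ξ - (γ ξ / γ u) • u) (by simp [hγ])
  simp only [map_sub, map_smul, smul_eq_mul, heu, mul_zero, sub_zero] at hproj
  simp only [sub_apply, smul_apply, smul_eq_mul, ← hproj]
  ring

/-- A sequence of constrained differentials `rₙ` tending to zero forces the full differentials `eₙ`
to tend to zero, because the Lagrange multipliers `rₙ uₙ / γₙ uₙ` do. -/
theorem tendsto_zero_of_eqOn_ker {e γ r : ℕ → H →L[ℝ] ℝ} {u : ℕ → H} {R l : ℝ}
    (heu : ∀ n, e n (u n) = 0) (h : ∀ n ξ, γ n ξ = 0 → r n ξ = e n ξ)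
    (hr : Tendsto r atTop (𝓝 0)) (hu : ∀ n, ‖u n‖ ≤ R)
    (hγ : IsBoundedUnder (· ≤ ·) atTop fun n => ‖γ n‖)
    (hγu : Tendsto (fun n => γ n (u n)) atTop (𝓝 l)) (hl : l ≠ 0) :
    Tendsto e atTop (𝓝 0) := by
  have hru : Tendsto (fun n => r n (u n)) atTop (𝓝 0) := by
    refine squeeze_zero_norm (fun n => (r n).le_opNorm_of_le (hu n)) ?_
    simpa using hr.norm.mul_const R
  have hmultiplier : Tendsto (fun n => r n (u n) / γ n (u n)) atTop (𝓝 0) := by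
    rw [← zero_div l]
    exact hru.div hγu hl
  have hlim : Tendsto (fun n => r n - (r n (u n) / γ n (u n)) • γ n) atTop (𝓝 0) := by
    simpa using hr.sub (hmultiplier.zero_smul_isBoundedUnder_le hγ)
  refine hlim.congr' ?_
  filter_upwards [hγu.eventually_ne hl] with n hn
  exact (eq_sub_smul_of_eqOn_ker hn (heu n) (h n)).symm

end Multiplier

variable {H X : Type*} [NormedAddCommGroup H] [InnerProductSpace ℝ H]
  [NormedAddCommGroup X] [NormedSpace ℝ X]

/-- The functional `u ↦ ½ (‖u‖² + b(Ju, Ju)) - s Q(Ju)` on a Hilbert space. If `Q` is homogeneous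
of degree `p`, the Nehari functional of the one with `s = 1 / p` is twice the one with
`s = 1 / 2`. -/
def homogeneousEnergy (J : H →L[ℝ] X) (b : X →L[ℝ] X →L[ℝ] ℝ) (Q : X → ℝ) (s : ℝ) (u : H) : ℝ :=
  1 / 2 * (‖u‖ ^ 2 + b (J u) (J u)) - s * Q (J u)

/-- The derivative at `x` of the lower order part `x ↦ ½ b(x, x) - s Q(x)` of
`homogeneousEnergy`. -/
def lowerOrderDeriv (b : X →L[ℝ] X →L[ℝ] ℝ) (Q : X → ℝ) (s : ℝ) (x : X) : X →L[ℝ] ℝ :=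
  (1 / 2 : ℝ) • (b x + b.flip x) - s • fderiv ℝ Q x

variable {J : H →L[ℝ] X} {b : X →L[ℝ] X →L[ℝ] ℝ} {Q : X → ℝ} {s p c C R : ℝ}

theorem continuous_lowerOrderDeriv (hQ : ContDiff ℝ 1 Q) : Continuous (lowerOrderDeriv b Q s) := by
  have := hQ.continuous_fderiv one_ne_zero
  unfold lowerOrderDeriv
  fun_prop

theorem hasFDerivAt_homogeneousEnergy {u : H} (hQ : DifferentiableAt ℝ Q (J u)) :
    HasFDerivAt (homogeneousEnergy J b Q s)
      (innerSL ℝ u + (lowerOrderDeriv b Q s (J u)).comp J) u := by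
  have hnorm : HasFDerivAt (fun u : H => ‖u‖ ^ 2) _ u := (hasStrictFDerivAt_norm_sq u).hasFDerivAt
  have hquad : HasFDerivAt (fun u => b (J u) (J u)) _ u :=
    b.hasFDerivAt_of_bilinear J.hasFDerivAt J.hasFDerivAt
  have hhom : HasFDerivAt (fun u => Q (J u)) _ u := hQ.hasFDerivAt.comp u J.hasFDerivAt
  refine (((hnorm.add hquad).const_mul (1 / 2)).sub (hhom.const_mul s)).congr_fderiv ?_
  ext ξ
  simp [lowerOrderDeriv]
  ring

theorem fderiv_homogeneousEnergy (hQ : ContDiff ℝ 1 Q) (u : H) :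
    fderiv ℝ (homogeneousEnergy J b Q s) u =
      innerSL ℝ u + (lowerOrderDeriv b Q s (J u)).comp J :=
  (hasFDerivAt_homogeneousEnergy (hQ.differentiable one_ne_zero _)).fderiv

theorem fderiv_homogeneousEnergy_self (hQ : ContDiff ℝ 1 Q)
    (hhom : ∀ t : ℝ, 0 < t → ∀ x, Q (t • x) = t ^ p * Q x) (u : H) :
    fderiv ℝ (homogeneousEnergy J b Q s) u u = ‖u‖ ^ 2 + b (J u) (J u) - s * p * Q (J u) := by
  have heuler := fderiv_apply_self_of_homogeneous (fun t ht => hhom t ht (J u))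
    (hQ.differentiable one_ne_zero _)
  rw [fderiv_homogeneousEnergy hQ]
  simp only [lowerOrderDeriv, add_apply, sub_apply, smul_apply, ContinuousLinearMap.comp_apply,
    ContinuousLinearMap.flip_apply, innerSL_apply_apply, real_inner_self_eq_norm_sq, smul_eq_mul,
    heuler]
  ring

theorem fderiv_homogeneousEnergy_self_eq (hQ : ContDiff ℝ 1 Q)
    (hhom : ∀ t : ℝ, 0 < t → ∀ x, Q (t • x) = t ^ p * Q x) (hp : p ≠ 0) :
    (fun u => fderiv ℝ (homogeneousEnergy J b Q (1 / p)) u u) =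
      fun u => 2 * homogeneousEnergy J b Q (1 / 2) u := by
  funext u
  rw [fderiv_homogeneousEnergy_self hQ hhom, homogeneousEnergy, one_div_mul_cancel hp]
  ring

theorem norm_sq_eq_of_fderiv_homogeneousEnergy_self_eq_zero (hQ : ContDiff ℝ 1 Q)
    (hhom : ∀ t : ℝ, 0 < t → ∀ x, Q (t • x) = t ^ p * Q x) (hp : p ≠ 0) {u : H}
    (hu : fderiv ℝ (homogeneousEnergy J b Q (1 / p)) u u = 0) :
    ‖u‖ ^ 2 = Q (J u) - b (J u) (J u) := by
  rw [fderiv_homogeneousEnergy_self hQ hhom, one_div_mul_cancel hp] at hu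
  linarith

theorem exists_norm_le_of_nehari (hQ : ContDiff ℝ 1 Q)
    (hhom : ∀ t : ℝ, 0 < t → ∀ x, Q (t • x) = t ^ p * Q x) (hp : 2 < p) (hc : 0 < c)
    (hcoer : ∀ x, c * ‖x‖ ^ p ≤ Q x) (C : ℝ) :
    ∃ R, ∀ u, fderiv ℝ (homogeneousEnergy J b Q (1 / p)) u u = 0 →
      homogeneousEnergy J b Q (1 / p) u ≤ C → ‖u‖ ≤ R := by
  have hp0 : 0 < p := by linarith
  have hgap : 0 < 1 / 2 - 1 / p := sub_pos.2 (one_div_lt_one_div_of_lt two_pos hp)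
  set K := C / (1 / 2 - 1 / p)
  set M := max 0 (K / c) ^ p⁻¹
  refine ⟨√(K + ‖b‖ * M * M), fun u hu hE => ?_⟩
  have hnehari := norm_sq_eq_of_fderiv_homogeneousEnergy_self_eq_zero hQ hhom hp0.ne' hu
  have hQK : Q (J u) ≤ K := by
    rw [homogeneousEnergy, hnehari] at hE
    rw [le_div_iff₀ hgap]
    linarith
  have hJM : ‖J u‖ ≤ M := by
    refine (Real.le_rpow_inv_iff_of_pos (norm_nonneg _) (le_max_left _ _) hp0).2
      (le_max_of_le_right ?_)
    rw [le_div_iff₀' hc]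
    exact (hcoer _).trans hQK
  have hb : |b (J u) (J u)| ≤ ‖b‖ * M * M :=
    (b.le_opNorm₂ _ _).trans (by gcongr)
  refine Real.le_sqrt_of_sq_le ?_
  linarith [neg_le_of_abs_le hb]

theorem tendsto_of_tendsto_fderiv_homogeneousEnergy [CompleteSpace H] (hQ : ContDiff ℝ 1 Q)
    {u : ℕ → H} {x : X} (hJ : Tendsto (fun n => J (u n)) atTop (𝓝 x))
    (hE : Tendsto (fun n => fderiv ℝ (homogeneousEnergy J b Q s) (u n)) atTop (𝓝 0)) :
    ∃ v, Tendsto u atTop (𝓝 v) := by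
  have hlower : Tendsto (fun n => (lowerOrderDeriv b Q s (J (u n))).comp J) atTop
      (𝓝 ((lowerOrderDeriv b Q s x).comp J)) :=
    (((ContinuousLinearMap.compL ℝ H X ℝ).flip J).continuous.comp
      (continuous_lowerOrderDeriv hQ)).tendsto x |>.comp hJ
  have hdual : Tendsto (fun n => InnerProductSpace.toDual ℝ H (u n)) atTop
      (𝓝 (0 - (lowerOrderDeriv b Q s x).comp J)) :=
    (hE.sub hlower).congr fun n => by
      rw [fderiv_homogeneousEnergy hQ, add_sub_cancel_right]
      rfl
  exact ⟨_, (((InnerProductSpace.toDual ℝ H).symm.continuous.tendsto _).comp hdual).congr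
    fun n => (InnerProductSpace.toDual ℝ H).symm_apply_apply (u n)⟩

theorem tendsto_fderiv_homogeneousEnergy_zero (hQ : ContDiff ℝ 1 Q)
    (hhom : ∀ t : ℝ, 0 < t → ∀ x, Q (t • x) = t ^ p * Q x) (hp : 2 < p) {u r : ℕ → H} {x : X}
    (hu : ∀ n, fderiv ℝ (homogeneousEnergy J b Q (1 / p)) (u n) (u n) = 0)
    (hR : ∀ n, ‖u n‖ ≤ R) (hJ : Tendsto (fun n => J (u n)) atTop (𝓝 x)) (hx : Q x ≠ 0)
    (hr : ∀ n ξ, fderiv ℝ (fun u => fderiv ℝ (homogeneousEnergy J b Q (1 / p)) u u) (u n) ξ = 0 →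
      inner ℝ (r n) ξ = fderiv ℝ (homogeneousEnergy J b Q (1 / p)) (u n) ξ)
    (hr0 : Tendsto (fun n => ‖r n‖) atTop (𝓝 0)) :
    Tendsto (fun n => fderiv ℝ (homogeneousEnergy J b Q (1 / p)) (u n)) atTop (𝓝 0) := by
  have hp0 : p ≠ 0 := by linarith
  have hdiff : ∀ v, DifferentiableAt ℝ (homogeneousEnergy J b Q (1 / 2)) v := fun v =>
    (hasFDerivAt_homogeneousEnergy (hQ.differentiable one_ne_zero _)).differentiableAt
  simp only [fderiv_homogeneousEnergy_self_eq hQ hhom hp0,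
    fun v => fderiv_const_mul (hdiff v) (2 : ℝ)] at hr
  have hr' : Tendsto (fun n => innerSL ℝ (r n)) atTop (𝓝 0) :=
    tendsto_zero_iff_norm_tendsto_zero.2 (by simpa only [innerSL_apply_norm] using hr0)
  refine tendsto_zero_of_eqOn_ker (l := (2 - p) * Q x) hu hr hr' hR ?_ ?_
    (mul_ne_zero (by linarith) hx)
  · obtain ⟨B, hB⟩ := ((continuous_lowerOrderDeriv (b := b) (s := 1 / 2) hQ).norm.tendsto
      x |>.comp hJ).isBoundedUnder_le
    refine ⟨2 * (R + B * ‖J‖), ?_⟩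
    rw [eventually_map] at hB ⊢
    filter_upwards [hB] with n hn
    rw [fderiv_homogeneousEnergy hQ, norm_smul, Real.norm_two]
    gcongr
    refine (norm_add_le _ _).trans (add_le_add ?_ ?_)
    · simpa only [innerSL_apply_norm] using hR n
    · exact (ContinuousLinearMap.opNorm_comp_le _ _).trans (by gcongr; exact hn)
  · refine (((hQ.continuous.tendsto x).comp hJ).const_mul (2 - p)).congr fun n => ?_
    have hn := norm_sq_eq_of_fderiv_homogeneousEnergy_self_eq_zero hQ hhom hp0 (hu n)
    rw [smul_apply, fderiv_homogeneousEnergy_self hQ hhom, smul_eq_mul, Function.comp_apply]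
    linear_combination -2 * hn

theorem exists_tendsto_subseq_of_nehari [CompleteSpace H] (hQ : ContDiff ℝ 1 Q)
    (hhom : ∀ t : ℝ, 0 < t → ∀ x, Q (t • x) = t ^ p * Q x) (hp : 2 < p) (hc : 0 < c)
    (hcoer : ∀ x, c * ‖x‖ ^ p ≤ Q x) (hJ : IsCompactOperator J) {u r : ℕ → H}
    (hu : ∀ n, fderiv ℝ (homogeneousEnergy J b Q (1 / p)) (u n) (u n) = 0)
    (hbdd : ∀ n, homogeneousEnergy J b Q (1 / p) (u n) ≤ C)
    (hr : ∀ n ξ, fderiv ℝ (fun u => fderiv ℝ (homogeneousEnergy J b Q (1 / p)) u u) (u n) ξ = 0 →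
      inner ℝ (r n) ξ = fderiv ℝ (homogeneousEnergy J b Q (1 / p)) (u n) ξ)
    (hr0 : Tendsto (fun n => ‖r n‖) atTop (𝓝 0)) :
    ∃ (v : H) (φ : ℕ → ℕ), StrictMono φ ∧ Tendsto (u ∘ φ) atTop (𝓝 v) := by
  have hp0 : 0 < p := by linarith
  obtain ⟨R, hR⟩ := exists_norm_le_of_nehari hQ hhom hp hc hcoer C (J := J) (b := b)
  have huR : ∀ n, ‖u n‖ ≤ R := fun n => hR _ (hu n) (hbdd n)
  obtain ⟨x, -, φ, hφ, hx⟩ := (hJ.isCompact_closure_image_closedBall R).tendsto_subseq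
    fun n => subset_closure ⟨u n, mem_closedBall_zero_iff.2 (huR n), rfl⟩
  rcases eq_or_ne x 0 with rfl | hx0
  · have hsq : Tendsto (fun n => ‖u (φ n)‖ ^ 2) atTop (𝓝 (Q 0 - b 0 0)) := by
      have hcont : Continuous fun x => Q x - b x x := hQ.continuous.sub (by fun_prop)
      exact ((hcont.tendsto 0).comp hx).congr fun n =>
        (norm_sq_eq_of_fderiv_homogeneousEnergy_self_eq_zero hQ hhom hp0.ne' (hu (φ n))).symm
    have hQ0 : Q 0 = 0 := by
      have heuler := fderiv_apply_self_of_homogeneous (fun t ht => hhom t ht 0)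
        (hQ.differentiable one_ne_zero _)
      simpa [hp0.ne'] using heuler
    rw [hQ0, map_zero, sub_zero] at hsq
    refine ⟨0, φ, hφ, tendsto_zero_iff_norm_tendsto_zero.2 ?_⟩
    simpa using hsq.sqrt
  · have hQx : 0 < Q x := lt_of_lt_of_le (by positivity) (hcoer x)
    have hE := tendsto_fderiv_homogeneousEnergy_zero hQ hhom hp (fun n => hu (φ n))
      (fun n => huR (φ n)) hx hQx.ne' (fun n => hr (φ n)) (hr0.comp hφ.tendsto_atTop)
    obtain ⟨v, hv⟩ := tendsto_of_tendsto_fderiv_homogeneousEnergy hQ hx hE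
    exact ⟨v, φ, hφ, hv⟩

end AbstractPalaisSmale
section LpNorms

variable {α F : Type*} [MeasurableSpace α] [NormedAddCommGroup F] {μ : Measure α}

theorem eLpNorm_ofNat_pow (n : ℕ) [n.AtLeastTwo] (f : α → F) (μ : Measure α) :
    eLpNorm f ofNat(n) μ ^ (ofNat(n) : ℕ) = ∫⁻ x, ‖f x‖ₑ ^ (ofNat(n) : ℕ) ∂μ := by
  simpa using eLpNorm_nnreal_pow_eq_lintegral (f := f) (μ := μ) (p := ofNat(n))
    (OfNat.ofNat_ne_zero n)

theorem eLpNorm_le_eLpNorm_mul_rpow_of_support_subset {s : Set α} {f : α → F}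
    (hf : AEStronglyMeasurable f μ) (hs : f.support ⊆ s) {p q : ℝ≥0∞} (hpq : p ≤ q) :
    eLpNorm f p μ ≤ eLpNorm f q μ * μ s ^ (1 / p.toReal - 1 / q.toReal) := by
  have h := eLpNorm_le_eLpNorm_mul_rpow_measure_univ (μ := μ.restrict s) hpq hf.restrict
  rwa [eLpNorm_restrict_eq_of_support_subset hs, eLpNorm_restrict_eq_of_support_subset hs,
    Measure.restrict_apply_univ] at h

theorem eLpNorm_four_pow_four_le {f : α → F} (hf : AEStronglyMeasurable f μ) :
    eLpNorm f 4 μ ^ 4 ≤ eLpNorm f 2 μ * eLpNorm f 6 μ ^ 3 := by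
  have hholder := ENNReal.lintegral_mul_norm_pow_le (hf.enorm.pow_const 2) (hf.enorm.pow_const 6)
    (p := 1 / 2) (q := 1 / 2) (by norm_num) (by norm_num) (by norm_num)
  rw [← eLpNorm_ofNat_pow, ← eLpNorm_ofNat_pow] at hholder
  simp only [← ENNReal.rpow_natCast_mul] at hholder
  norm_num [← pow_succ'] at hholder
  rwa [← eLpNorm_ofNat_pow] at hholder

theorem lintegral_sq_le_lintegral_sq [IsProbabilityMeasure μ] {f : α → ℝ≥0∞}
    (hf : AEMeasurable f μ) : (∫⁻ x, f x ∂μ) ^ 2 ≤ ∫⁻ x, f x ^ 2 ∂μ := by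
  have hholder := ENNReal.lintegral_mul_le_Lp_mul_Lq μ Real.HolderConjugate.two_two hf
    (aemeasurable_const (b := 1))
  simp only [Pi.mul_apply, mul_one, ENNReal.one_rpow, lintegral_const, measure_univ] at hholder
  calc (∫⁻ x, f x ∂μ) ^ 2 ≤ ((∫⁻ x, f x ^ (2 : ℝ) ∂μ) ^ (1 / 2 : ℝ)) ^ 2 := by gcongr
    _ = ∫⁻ x, f x ^ 2 ∂μ := by
      rw [← ENNReal.rpow_mul_natCast]
      norm_num

end LpNorms

section Sobolev

open scoped NNReal

theorem exists_eLpNorm_fderiv_le {E : Type*} [NormedAddCommGroup E] [NormedSpace ℝ E]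
    [FiniteDimensional ℝ E] [MeasurableSpace E] [BorelSpace E] {μ : Measure E}
    [IsFiniteMeasureOnCompacts μ] {s : Set E} (hs : Bornology.IsBounded s) {p q : ℝ≥0∞}
    (hp : p ≠ 0) (hpq : p ≤ q) (hq : q ≠ ∞) :
    ∃ C : ℝ≥0, ∀ φ : E → ℝ, ContDiff ℝ 1 φ → tsupport φ ⊆ s →
      eLpNorm (fderiv ℝ φ) p μ ≤ C * eLpNorm (fderiv ℝ φ) q μ := by
  have : ProperSpace E := FiniteDimensional.proper ℝ E
  have hexp : 0 ≤ 1 / p.toReal - 1 / q.toReal := sub_nonneg.2 <|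
    one_div_le_one_div_of_le (ENNReal.toReal_pos hp (ne_top_of_le_ne_top hq hpq))
      (ENNReal.toReal_mono hq hpq)
  refine ⟨(μ s ^ (1 / p.toReal - 1 / q.toReal)).toNNReal, fun φ hφ hsub => ?_⟩
  rw [ENNReal.coe_toNNReal (ENNReal.rpow_ne_top_of_nonneg hexp hs.measure_lt_top.ne), mul_comm]
  exact eLpNorm_le_eLpNorm_mul_rpow_of_support_subset
    (hφ.continuous_fderiv one_ne_zero).aestronglyMeasurable
    ((subset_tsupport _).trans ((tsupport_fderiv_subset ℝ).trans hsub)) hpq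

theorem enorm_le_eLpNorm_fderiv_one {φ : EuclideanSpace ℝ (Fin 1) → ℝ} (hφ : ContDiff ℝ 1 φ)
    (hc : HasCompactSupport φ) (x : EuclideanSpace ℝ (Fin 1)) :
    ‖φ x‖ₑ ≤ eLpNorm (fderiv ℝ φ) 1 volume := by
  let e := (OrthonormalBasis.singleton (Fin 1) ℝ).repr
  have hmp : MeasurePreserving e volume volume :=
    (OrthonormalBasis.singleton (Fin 1) ℝ).measurePreserving_repr
  have hderiv (y : ℝ) : ‖deriv (φ ∘ e) y‖ₑ ≤ ‖fderiv ℝ φ (e y)‖ₑ := by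
    have he : HasDerivAt e (e 1) y := by
      simpa using (e.toContinuousLinearEquiv.hasFDerivAt (x := y)).hasDerivAt
    rw [((hφ.differentiable one_ne_zero (e y)).hasFDerivAt.comp_hasDerivAt y he).deriv]
    have he1 : ‖e 1‖ₑ = 1 := (e.enorm_map 1).trans enorm_one
    simpa [he1] using (fderiv ℝ φ (e y)).le_opENorm (e 1)
  calc ‖φ x‖ₑ = ‖(φ ∘ e) (e.symm x)‖ₑ := by rw [Function.comp_apply, e.apply_symm_apply]
    _ ≤ ∫⁻ y in Iic (e.symm x), ‖deriv (φ ∘ e) y‖ₑ :=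
      HasCompactSupport.enorm_le_lintegral_Ici_deriv (hφ.comp e.contDiff)
        (hc.comp_homeomorph e.toHomeomorph) _
    _ ≤ ∫⁻ y, ‖deriv (φ ∘ e) y‖ₑ := setLIntegral_le_lintegral _ _
    _ ≤ ∫⁻ y, ‖fderiv ℝ φ (e y)‖ₑ := lintegral_mono hderiv
    _ = eLpNorm (fderiv ℝ φ) 1 volume := by
      rw [hmp.lintegral_comp (hφ.continuous_fderiv one_ne_zero).enorm.measurable,
        eLpNorm_one_eq_lintegral_enorm]

theorem exists_eLpNorm_six_le_of_dim_one {s : Set (EuclideanSpace ℝ (Fin 1))}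
    (hs : Bornology.IsBounded s) :
    ∃ C : ℝ≥0, ∀ φ : EuclideanSpace ℝ (Fin 1) → ℝ, ContDiff ℝ 1 φ → HasCompactSupport φ →
      tsupport φ ⊆ s → eLpNorm φ 6 volume ≤ C * eLpNorm (fderiv ℝ φ) 2 volume := by
  obtain ⟨C, hC⟩ := exists_eLpNorm_fderiv_le (μ := volume) hs one_ne_zero one_le_two
    ENNReal.ofNat_ne_top
  refine ⟨(volume s ^ (1 / (6 : ℝ))).toNNReal * C, fun φ hφ hc hsub => ?_⟩
  calc eLpNorm φ 6 volume ≤ eLpNorm φ ∞ volume * volume s ^ (1 / (6 : ℝ)) := by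
        simpa using eLpNorm_le_eLpNorm_mul_rpow_of_support_subset (μ := volume) (p := 6)
          hφ.continuous.aestronglyMeasurable ((subset_tsupport φ).trans hsub) le_top
    _ ≤ eLpNorm (fderiv ℝ φ) 1 volume * volume s ^ (1 / (6 : ℝ)) := by
        gcongr
        exact eLpNormEssSup_le_of_ae_enorm_bound
          (.of_forall fun x => enorm_le_eLpNorm_fderiv_one hφ hc x)
    _ ≤ C * eLpNorm (fderiv ℝ φ) 2 volume * volume s ^ (1 / (6 : ℝ)) := by
        gcongr
        exact hC φ hφ hsub
    _ = ↑((volume s ^ (1 / (6 : ℝ))).toNNReal * C) * eLpNorm (fderiv ℝ φ) 2 volume := by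
        rw [ENNReal.coe_mul, ENNReal.coe_toNNReal (ENNReal.rpow_ne_top_of_nonneg (by norm_num)
          hs.measure_lt_top.ne)]
        ring

/-- The exponent `6n / (6 + n) ≤ 2` is the one whose Sobolev conjugate is `6`. -/
theorem exists_eLpNorm_six_le_of_two_le_finrank {E : Type*} [NormedAddCommGroup E]
    [NormedSpace ℝ E] [FiniteDimensional ℝ E] [MeasurableSpace E] [BorelSpace E] {μ : Measure E}
    [μ.IsAddHaarMeasure] (h2 : 2 ≤ Module.finrank ℝ E) (h3 : Module.finrank ℝ E ≤ 3) {s : Set E}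
    (hs : Bornology.IsBounded s) :
    ∃ C : ℝ≥0, ∀ φ : E → ℝ, ContDiff ℝ 1 φ → tsupport φ ⊆ s →
      eLpNorm φ 6 μ ≤ C * eLpNorm (fderiv ℝ φ) 2 μ := by
  set n := Module.finrank ℝ E
  set p : ℝ≥0 := 6 * n / (6 + n) with hp
  have h2' : (2 : ℝ) ≤ n := mod_cast h2
  have h3' : (n : ℝ) ≤ 3 := mod_cast h3
  have hp1 : 1 ≤ p := by
    rw [hp, one_le_div (by positivity), ← NNReal.coe_le_coe]
    push_cast
    linarith
  have hp2 : p ≤ 2 := by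
    rw [hp, div_le_iff₀ (by positivity), ← NNReal.coe_le_coe]
    push_cast
    linarith
  have hpn : p < n := by
    rw [hp, div_lt_iff₀ (by positivity), ← NNReal.coe_lt_coe]
    push_cast
    nlinarith
  have hconj : (p⁻¹ - (n : ℝ)⁻¹ : ℝ) ≤ ((6 : ℝ≥0) : ℝ)⁻¹ := by
    rw [hp]
    push_cast
    field_simp
    linarith
  obtain ⟨C, hC⟩ := exists_eLpNorm_fderiv_le (μ := μ) hs (p := p) (q := 2)
    (by simpa using (zero_lt_one.trans_le hp1).ne') (mod_cast hp2) ENNReal.ofNat_ne_top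
  refine ⟨eLpNormLESNormFDerivOfLeConst ℝ μ s p 6 * C, fun φ hφ hsub => ?_⟩
  calc eLpNorm φ 6 μ ≤ eLpNormLESNormFDerivOfLeConst ℝ μ s p 6 * eLpNorm (fderiv ℝ φ) p μ :=
        eLpNorm_le_eLpNorm_fderiv_of_le μ hφ ((subset_tsupport φ).trans hsub) hp1 hpn hconj hs
    _ ≤ eLpNormLESNormFDerivOfLeConst ℝ μ s p 6 * (C * eLpNorm (fderiv ℝ φ) 2 μ) := by
        gcongr
        exact hC φ hφ hsub
    _ = ↑(eLpNormLESNormFDerivOfLeConst ℝ μ s p 6 * C) * eLpNorm (fderiv ℝ φ) 2 μ := by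
        rw [ENNReal.coe_mul, mul_assoc]

theorem exists_eLpNorm_six_le_eLpNorm_fderiv_two {N : ℕ} [NeZero N] (hN : N ≤ 3)
    {s : Set (EuclideanSpace ℝ (Fin N))} (hs : Bornology.IsBounded s) :
    ∃ C : ℝ≥0, ∀ φ : EuclideanSpace ℝ (Fin N) → ℝ, ContDiff ℝ 1 φ → HasCompactSupport φ →
      tsupport φ ⊆ s → eLpNorm φ 6 volume ≤ C * eLpNorm (fderiv ℝ φ) 2 volume := by
  rcases (NeZero.one_le : 1 ≤ N).eq_or_lt with rfl | h2
  · exact exists_eLpNorm_six_le_of_dim_one hs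
  · obtain ⟨C, hC⟩ := exists_eLpNorm_six_le_of_two_le_finrank (μ := volume)
      (by simpa using Nat.succ_le_of_lt h2) (by simpa using hN) hs
    exact ⟨C, fun φ hφ _ => hC φ hφ⟩

end Sobolev

section BallAverage

theorem enorm_sub_setAverage_sq_le {α : Type*} [MeasurableSpace α] {μ : Measure α} {s : Set α}
    (hs0 : μ s ≠ 0) (hs : μ s ≠ ∞) {f : α → ℝ} (hf : IntegrableOn f s μ) (c : ℝ) :
    ‖c - ⨍ z in s, f z ∂μ‖ₑ ^ 2 ≤ (μ s)⁻¹ * ∫⁻ z in s, ‖c - f z‖ₑ ^ 2 ∂μ := by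
  have : IsProbabilityMeasure ((μ s)⁻¹ • μ.restrict s) :=
    ⟨by simp [ENNReal.inv_mul_cancel hs0 hs]⟩
  have hint : Integrable f ((μ s)⁻¹ • μ.restrict s) := hf.smul_measure (ENNReal.inv_ne_top.2 hs0)
  have hdiff : c - ⨍ z in s, f z ∂μ = ∫ z, (c - f z) ∂((μ s)⁻¹ • μ.restrict s) := by
    rw [integral_sub (integrable_const c) hint, setAverage_eq', integral_const, probReal_univ,
      one_smul]
  calc ‖c - ⨍ z in s, f z ∂μ‖ₑ ^ 2
      ≤ (∫⁻ z, ‖c - f z‖ₑ ∂((μ s)⁻¹ • μ.restrict s)) ^ 2 := by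
        rw [hdiff]
        gcongr
        exact enorm_integral_le_lintegral_enorm _
    _ ≤ ∫⁻ z, ‖c - f z‖ₑ ^ 2 ∂((μ s)⁻¹ • μ.restrict s) :=
        lintegral_sq_le_lintegral_sq
          (aestronglyMeasurable_const.sub hint.aestronglyMeasurable).enorm
    _ = (μ s)⁻¹ * ∫⁻ z in s, ‖c - f z‖ₑ ^ 2 ∂μ := by
        rw [lintegral_smul_measure, smul_eq_mul]

variable {E : Type*} [NormedAddCommGroup E] [NormedSpace ℝ E]

theorem enorm_sub_sq_le_lintegral_fderiv {φ : E → ℝ} (hφ : ContDiff ℝ 1 φ) (x h : E) :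
    ‖φ (x + h) - φ x‖ₑ ^ 2 ≤
      ‖h‖ₑ ^ 2 * ∫⁻ t in Ioc (0 : ℝ) 1, ‖fderiv ℝ φ (x + t • h)‖ₑ ^ 2 := by
  have hcont : Continuous fun t : ℝ => fderiv ℝ φ (x + t • h) :=
    (hφ.continuous_fderiv one_ne_zero).comp (by fun_prop)
  have hderiv (t : ℝ) : HasDerivAt (fun t : ℝ => φ (x + t • h)) (fderiv ℝ φ (x + t • h) h) t := by
    have hline : HasDerivAt (fun t : ℝ => x + t • h) h t := by
      simpa using ((hasDerivAt_id t).smul_const h).const_add x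
    exact ((hφ.differentiable one_ne_zero) _).hasFDerivAt.comp_hasDerivAt t hline
  have hftc : ∫ t in Ioc (0 : ℝ) 1, fderiv ℝ φ (x + t • h) h = φ (x + h) - φ x := by
    simpa [intervalIntegral.integral_of_le zero_le_one] using
      intervalIntegral.integral_eq_sub_of_hasDerivAt (a := 0) (b := 1) (fun t _ => hderiv t)
        ((hcont.clm_apply continuous_const).intervalIntegrable 0 1)
  have : IsProbabilityMeasure (volume.restrict (Ioc (0 : ℝ) 1)) := ⟨by simp⟩
  calc ‖φ (x + h) - φ x‖ₑ ^ 2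
      ≤ (∫⁻ t in Ioc (0 : ℝ) 1, ‖fderiv ℝ φ (x + t • h) h‖ₑ) ^ 2 := by
        rw [← hftc]
        gcongr
        exact enorm_integral_le_lintegral_enorm _
    _ ≤ ∫⁻ t in Ioc (0 : ℝ) 1, ‖fderiv ℝ φ (x + t • h) h‖ₑ ^ 2 :=
        lintegral_sq_le_lintegral_sq
          (hcont.clm_apply continuous_const).enorm.measurable.aemeasurable
    _ ≤ ∫⁻ t in Ioc (0 : ℝ) 1, ‖h‖ₑ ^ 2 * ‖fderiv ℝ φ (x + t • h)‖ₑ ^ 2 := by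
        refine lintegral_mono fun t => ?_
        rw [← mul_pow, mul_comm]
        gcongr
        exact ContinuousLinearMap.le_opENorm _ _
    _ = ‖h‖ₑ ^ 2 * ∫⁻ t in Ioc (0 : ℝ) 1, ‖fderiv ℝ φ (x + t • h)‖ₑ ^ 2 :=
        lintegral_const_mul _ (hcont.enorm.measurable.pow_const 2)

variable [MeasurableSpace E] [BorelSpace E] [FiniteDimensional ℝ E] {μ : Measure E}
  [μ.IsAddHaarMeasure]

theorem lintegral_enorm_translate_sub_sq_le {φ : E → ℝ} (hφ : ContDiff ℝ 1 φ) (h : E) :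
    ∫⁻ x, ‖φ (x + h) - φ x‖ₑ ^ 2 ∂μ ≤ ‖h‖ₑ ^ 2 * ∫⁻ x, ‖fderiv ℝ φ x‖ₑ ^ 2 ∂μ := by
  have hcont : Continuous fun p : E × ℝ => fderiv ℝ φ (p.1 + p.2 • h) :=
    (hφ.continuous_fderiv one_ne_zero).comp (by fun_prop)
  calc ∫⁻ x, ‖φ (x + h) - φ x‖ₑ ^ 2 ∂μ
      ≤ ∫⁻ x, ‖h‖ₑ ^ 2 * (∫⁻ t in Ioc (0 : ℝ) 1, ‖fderiv ℝ φ (x + t • h)‖ₑ ^ 2) ∂μ :=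
        lintegral_mono fun x => enorm_sub_sq_le_lintegral_fderiv hφ x h
    _ = ‖h‖ₑ ^ 2 * ∫⁻ x, (∫⁻ t in Ioc (0 : ℝ) 1, ‖fderiv ℝ φ (x + t • h)‖ₑ ^ 2) ∂μ :=
        lintegral_const_mul' _ _ (by simp)
    _ = ‖h‖ₑ ^ 2 * ∫⁻ t in Ioc (0 : ℝ) 1, ∫⁻ x, ‖fderiv ℝ φ (x + t • h)‖ₑ ^ 2 ∂μ := by
        rw [lintegral_lintegral_swap (hcont.enorm.measurable.pow_const 2).aemeasurable]
    _ = ‖h‖ₑ ^ 2 * ∫⁻ x, ‖fderiv ℝ φ x‖ₑ ^ 2 ∂μ := by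
        simp only [lintegral_add_right_eq_self (μ := μ) fun x => ‖fderiv ℝ φ x‖ₑ ^ 2,
          setLIntegral_const, Real.volume_Ioc, sub_zero, ENNReal.ofReal_one, mul_one]

theorem enorm_sub_setAverage_ball_sq_le {f : E → ℝ} (hf : Continuous f) {δ : ℝ} {x y : E}
    (hxy : dist y x < δ) :
    ‖f x - ⨍ z in Metric.ball y δ, f z ∂μ‖ₑ ^ 2 ≤ (μ (Metric.ball 0 δ))⁻¹ *
      ∫⁻ h in Metric.ball 0 (2 * δ), ‖f (x + h) - f x‖ₑ ^ 2 ∂μ := by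
  have hδ : 0 < δ := dist_nonneg.trans_lt hxy
  have : ProperSpace E := FiniteDimensional.proper ℝ E
  have hint : IntegrableOn f (Metric.ball y δ) μ :=
    (hf.continuousOn.integrableOn_compact (isCompact_closedBall y δ)).mono_set
      Metric.ball_subset_closedBall
  calc ‖f x - ⨍ z in Metric.ball y δ, f z ∂μ‖ₑ ^ 2
      ≤ (μ (Metric.ball y δ))⁻¹ * ∫⁻ z in Metric.ball y δ, ‖f x - f z‖ₑ ^ 2 ∂μ :=
        enorm_sub_setAverage_sq_le (Metric.measure_ball_pos μ y hδ).ne' measure_ball_lt_top.ne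
          hint (f x)
    _ ≤ (μ (Metric.ball 0 δ))⁻¹ * ∫⁻ z in Metric.ball x (2 * δ), ‖f x - f z‖ₑ ^ 2 ∂μ := by
        rw [Measure.addHaar_ball_center]
        gcongr
        exact Metric.ball_subset_ball' (by linarith)
    _ = (μ (Metric.ball 0 δ))⁻¹ *
          ∫⁻ h in Metric.ball 0 (2 * δ), ‖f (x + h) - f x‖ₑ ^ 2 ∂μ := by
        have hpre : (x + ·) ⁻¹' Metric.ball x (2 * δ) = Metric.ball 0 (2 * δ) := by
          simp [preimage_add_ball]
        rw [← hpre, (measurePreserving_add_left μ x).setLIntegral_comp_preimage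
          measurableSet_ball (f := fun z => ‖f z - f x‖ₑ ^ 2) (by fun_prop)]
        simp_rw [enorm_sub_rev]

theorem lintegral_average_translate_sub_sq_le {φ : E → ℝ} (hφ : ContDiff ℝ 1 φ) {δ : ℝ}
    (hδ : 0 < δ) :
    ∫⁻ x, (μ (Metric.ball 0 δ))⁻¹ *
        ∫⁻ h in Metric.ball 0 (2 * δ), ‖φ (x + h) - φ x‖ₑ ^ 2 ∂μ ∂μ ≤
      ENNReal.ofReal (2 ^ Module.finrank ℝ E * (2 * δ) ^ 2) * ∫⁻ x, ‖fderiv ℝ φ x‖ₑ ^ 2 ∂μ := by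
  have hμ0 : μ (Metric.ball 0 δ) ≠ 0 := (Metric.measure_ball_pos μ 0 hδ).ne'
  have hcont : Continuous φ := hφ.continuous
  set D : ℝ≥0∞ := ∫⁻ x, ‖fderiv ℝ φ x‖ₑ ^ 2 ∂μ
  calc ∫⁻ x, (μ (Metric.ball 0 δ))⁻¹ *
        ∫⁻ h in Metric.ball 0 (2 * δ), ‖φ (x + h) - φ x‖ₑ ^ 2 ∂μ ∂μ
      = (μ (Metric.ball 0 δ))⁻¹ *
          ∫⁻ h in Metric.ball 0 (2 * δ), ∫⁻ x, ‖φ (x + h) - φ x‖ₑ ^ 2 ∂μ ∂μ := by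
        rw [lintegral_const_mul' _ _ (ENNReal.inv_ne_top.2 hμ0), lintegral_lintegral_swap]
        exact Measurable.aemeasurable (by fun_prop)
    _ ≤ (μ (Metric.ball 0 δ))⁻¹ * ∫⁻ _ in Metric.ball 0 (2 * δ),
          (ENNReal.ofReal (2 * δ) ^ 2 * D) ∂μ := by
        refine mul_le_mul' le_rfl (setLIntegral_mono' measurableSet_ball fun h hh => ?_)
        refine (lintegral_enorm_translate_sub_sq_le hφ h).trans ?_
        gcongr
        rw [← ofReal_norm]
        exact ENNReal.ofReal_le_ofReal (mem_ball_zero_iff.1 hh).le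
    _ = ((μ (Metric.ball 0 δ))⁻¹ * μ (Metric.ball 0 δ)) *
          (ENNReal.ofReal (2 ^ Module.finrank ℝ E) * ENNReal.ofReal (2 * δ) ^ 2 * D) := by
        rw [setLIntegral_const, Measure.addHaar_ball_mul_of_pos μ 0 two_pos δ]
        ring
    _ = ENNReal.ofReal (2 ^ Module.finrank ℝ E * (2 * δ) ^ 2) * D := by
        rw [ENNReal.inv_mul_cancel hμ0 measure_ball_lt_top.ne, one_mul,
          ← ENNReal.ofReal_pow (by positivity), ← ENNReal.ofReal_mul (by positivity)]

theorem setLIntegral_enorm_sub_setAverage_ball_sq_le {φ : E → ℝ} (hφ : ContDiff ℝ 1 φ) {δ : ℝ}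
    (hδ : 0 < δ) {s : Set E} (hs : MeasurableSet s) {p : E → E} (hp : ∀ x ∈ s, dist (p x) x < δ) :
    ∫⁻ x in s, ‖φ x - ⨍ z in Metric.ball (p x) δ, φ z ∂μ‖ₑ ^ 2 ∂μ ≤
      ENNReal.ofReal (2 ^ Module.finrank ℝ E * (2 * δ) ^ 2) * ∫⁻ x, ‖fderiv ℝ φ x‖ₑ ^ 2 ∂μ :=
  (setLIntegral_mono' hs fun _ hx => enorm_sub_setAverage_ball_sq_le hφ.continuous (hp _ hx)).trans
    ((setLIntegral_le_lintegral s _).trans (lintegral_average_translate_sub_sq_le hφ hδ))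

end BallAverage

section CompactOperators

open scoped NNReal

theorem exists_simpleFunc_dist_lt {X : Type*} [PseudoMetricSpace X] [Nonempty X]
    [MeasurableSpace X] [OpensMeasurableSpace X] {s : Set X} (hs : TotallyBounded s) {δ : ℝ}
    (hδ : 0 < δ) : ∃ π : SimpleFunc X X, ∀ x ∈ s, dist (π x) x < δ := by
  obtain ⟨t, ht, hst⟩ := Metric.totallyBounded_iff.1 hs δ hδ
  obtain ⟨e, hte⟩ := countable_iff_exists_subset_range.1 ht.countable
  choose! i hi using hte
  obtain ⟨n, hn⟩ := (ht.image i).bddAbove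
  refine ⟨SimpleFunc.nearestPt e n, fun x hx => ?_⟩
  obtain ⟨y, hy, hxy⟩ := mem_iUnion₂.1 (hst hx)
  have hle := SimpleFunc.edist_nearestPt_le e x (hn (mem_image_of_mem i hy))
  rw [hi hy] at hle
  exact edist_lt_ofReal.1 (hle.trans_lt (edist_lt_ofReal.2 (Metric.mem_ball'.1 hxy)))

theorem isCompactOperator_smulRight {F G : Type*} [NormedAddCommGroup F] [NormedSpace ℝ F]
    [NormedAddCommGroup G] [NormedSpace ℝ G] (ℓ : F →L[ℝ] ℝ) (y : G) :
    IsCompactOperator (ℓ.smulRight y) :=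
  (isCompactOperator_of_locallyCompactSpace_rng
    (ContinuousLinearMap.toSpanSingleton ℝ y)).comp_clm ℓ

theorem exists_isCompactOperator_ae_eq_comp_simpleFunc {α β F : Type*} [MeasurableSpace α]
    {μ : Measure α} [IsFiniteMeasure μ] [NormedAddCommGroup F] [NormedSpace ℝ F] (p : ℝ≥0∞)
    [Fact (1 ≤ p)] (π : SimpleFunc α β) (ℓ : β → F →L[ℝ] ℝ) :
    ∃ A : F →L[ℝ] Lp ℝ p μ, IsCompactOperator A ∧ ∀ f, A f =ᵐ[μ] fun x => ℓ (π x) f := by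
  let χ (y : β) : Lp ℝ p μ :=
    indicatorConstLp p (π.measurableSet_fiber y) (measure_ne_top μ _) 1
  refine ⟨∑ y ∈ π.range, (ℓ y).smulRight (χ y), ?_, fun f => ?_⟩
  · exact Submodule.sum_mem (compactOperator (RingHom.id ℝ) F (Lp ℝ p μ))
      fun y _ => isCompactOperator_smulRight (ℓ y) (χ y)
  · have hsmul : ∀ᵐ x ∂μ, ∀ y ∈ π.range,
        (ℓ y f • χ y : Lp ℝ p μ) x = ℓ y f * (π ⁻¹' {y}).indicator (fun _ => 1) x := by
      refine (ae_ball_iff π.range.countable_toSet).2 fun y _ => ?_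
      filter_upwards [Lp.coeFn_smul (ℓ y f) (χ y), indicatorConstLp_coeFn (p := p) (μ := μ)
        (hs := π.measurableSet_fiber y) (hμs := measure_ne_top μ _) (c := (1 : ℝ))] with x hx hχ
      rw [hx, Pi.smul_apply, hχ, smul_eq_mul]
    filter_upwards [Lp.coeFn_finsetSum π.range fun y => ℓ y f • χ y, hsmul] with x hx hsmul
    simp only [_root_.sum_apply, ContinuousLinearMap.smulRight_apply]
    rw [hx, Finset.sum_apply, Finset.sum_congr rfl hsmul,
      Finset.sum_eq_single_of_mem (π x) (π.mem_range_self x) fun y _ hy => by simp [hy.symm]]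
    simp

theorem isCompactOperator_of_norm_pow_succ_le {F G K : Type*} [NormedAddCommGroup F]
    [NormedSpace ℝ F] [NormedAddCommGroup G] [NormedSpace ℝ G] [NormedAddCommGroup K]
    [NormedSpace ℝ K] [CompleteSpace K] {S : F →L[ℝ] G} (hS : IsCompactOperator S)
    {T : F →L[ℝ] K} {C : ℝ≥0} {k : ℕ} (hT : ∀ u, ‖T u‖ ^ (k + 1) ≤ ‖S u‖ * (C * ‖u‖) ^ k) :
    IsCompactOperator T := by
  have hSball := (hS.isCompact_closure_image_ball 1).totallyBounded.subset subset_closure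
  refine (isCompactOperator_iff_isCompact_closure_image_ball T.toLinearMap one_pos).2 <|
    TotallyBounded.isCompact_of_isClosed (TotallyBounded.closure <|
      Metric.totallyBounded_iff.2 fun ε hε => ?_) isClosed_closure
  set η := ε ^ (k + 1) / ((C * 2) ^ k + 1) with hη
  obtain ⟨t, hts, htf, htc⟩ := Metric.finite_approx_of_totallyBounded hSball η (by positivity)
  obtain ⟨s, hs, hsf, rfl⟩ := exists_subset_image_finite_and.1 ⟨t, hts, htf, rfl⟩
  refine ⟨T '' s, hsf.image T, ?_⟩
  rintro _ ⟨u, hu, rfl⟩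
  obtain ⟨_, ⟨v, hv, rfl⟩, huv⟩ := mem_iUnion₂.1 (htc (mem_image_of_mem _ hu))
  refine mem_iUnion₂.2 ⟨T v, mem_image_of_mem _ hv, ?_⟩
  have huv2 : ‖u - v‖ ≤ 2 := by
    linarith [norm_sub_le u v, mem_ball_zero_iff.1 hu, mem_ball_zero_iff.1 (hs hv)]
  rw [Metric.mem_ball, dist_eq_norm, ContinuousLinearMap.coe_coe, ← map_sub] at huv ⊢
  refine lt_of_pow_lt_pow_left₀ (k + 1) hε.le ?_
  calc ‖T (u - v)‖ ^ (k + 1) ≤ ‖S (u - v)‖ * (C * ‖u - v‖) ^ k := hT (u - v)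
    _ ≤ η * (C * 2) ^ k := by gcongr
    _ < η * ((C * 2) ^ k + 1) := by gcongr; linarith
    _ = ε ^ (k + 1) := by rw [hη]; field_simp

theorem isCompactOperator_pi {F ι : Type*} [Finite ι] [NormedAddCommGroup F] [NormedSpace ℝ F]
    {G : ι → Type*} [∀ i, NormedAddCommGroup (G i)] [∀ i, NormedSpace ℝ (G i)]
    {T : ∀ i, F →L[ℝ] G i} (hT : ∀ i, IsCompactOperator (T i)) :
    IsCompactOperator (ContinuousLinearMap.pi T) := by
  choose K hK hKT using hT
  exact ⟨Set.pi univ K, isCompact_univ_pi hK,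
    Filter.mem_of_superset (Filter.iInter_mem.2 hKT) fun x hx i _ => mem_iInter.1 hx i⟩

end CompactOperators

section LpLimits

variable {α F G : Type*} [MeasurableSpace α] {μ : Measure α} [NormedAddCommGroup F]
  [NormedAddCommGroup G]

theorem isClosed_setOf_eLpNorm_fst_le {p q : ℝ≥0∞} [Fact (1 ≤ p)] {C : ℝ≥0∞} (hC : C ≠ ∞) :
    IsClosed {x : Lp F p μ × G | eLpNorm x.1 q μ ≤ C * ‖x.2‖ₑ} := by
  refine isSeqClosed_iff_isClosed.1 fun x y hx hxy => ?_
  obtain ⟨ns, hns, hae⟩ := (tendstoInMeasure_of_tendsto_Lp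
    ((continuous_fst.tendsto y).comp hxy)).exists_seq_tendsto_ae
  have hlim : Tendsto (fun n => C * ‖(x (ns n)).2‖ₑ) atTop (𝓝 (C * ‖y.2‖ₑ)) :=
    ENNReal.Tendsto.const_mul (((continuous_enorm.comp continuous_snd).tendsto y).comp
      (hxy.comp hns.tendsto_atTop)) (.inr hC)
  calc eLpNorm y.1 q μ ≤ liminf (fun n => eLpNorm (x (ns n)).1 q μ) atTop :=
        Lp.eLpNorm_lim_le_liminf_eLpNorm (fun n => Lp.aestronglyMeasurable _) _ hae
    _ ≤ liminf (fun n => C * ‖(x (ns n)).2‖ₑ) atTop :=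
        liminf_le_liminf (.of_forall fun n => hx (ns n))
    _ = C * ‖y.2‖ₑ := hlim.liminf_eq

end LpLimits

theorem enorm_gradient {F : Type*} [NormedAddCommGroup F] [InnerProductSpace ℝ F]
    [CompleteSpace F] (φ : F → ℝ) (x : F) : ‖∇ φ x‖ₑ = ‖fderiv ℝ φ x‖ₑ :=
  (InnerProductSpace.toDual ℝ F).symm.enorm_map (fderiv ℝ φ x)

theorem support_gradient_subset {F : Type*} [NormedAddCommGroup F] [InnerProductSpace ℝ F]
    [CompleteSpace F] (φ : F → ℝ) : (∇ φ).support ⊆ tsupport φ := fun x hx =>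
  support_fderiv_subset ℝ fun h => hx (by rw [gradient, h, map_zero])

namespace BoundedDomain

open scoped NNReal

variable {N : ℕ} {Ω : BoundedDomain N}

instance : IsFiniteMeasure Ω.measure := ⟨by simpa using Ω.isBounded.measure_lt_top⟩

theorem eLpNorm_fderiv_eq_enorm {φ : EuclideanSpace ℝ (Fin N) → ℝ}
    {f : Lp (EuclideanSpace ℝ (Fin N)) 2 Ω.measure} (hφ : tsupport φ ⊆ Ω.carrier)
    (hf : f =ᵐ[Ω.measure] ∇ φ) : eLpNorm (fderiv ℝ φ) 2 volume = ‖f‖ₑ := by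
  calc eLpNorm (fderiv ℝ φ) 2 volume = eLpNorm (∇ φ) 2 volume :=
        eLpNorm_congr_enorm_ae (.of_forall fun x => (enorm_gradient φ x).symm)
    _ = eLpNorm (∇ φ) 2 Ω.measure :=
        (eLpNorm_restrict_eq_of_support_subset ((support_gradient_subset φ).trans hφ)).symm
    _ = ‖f‖ₑ := by rw [Lp.enorm_def, eLpNorm_congr_ae hf]

theorem exists_contDiff_of_mem_testPairs {p : Ω.L2Pair} (hp : p ∈ Ω.testPairs) :
    ∃ φ : EuclideanSpace ℝ (Fin N) → ℝ, ContDiff ℝ 1 φ ∧ HasCompactSupport φ ∧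
      tsupport φ ⊆ Ω.carrier ∧ p.1 =ᵐ[Ω.measure] φ ∧ eLpNorm (fderiv ℝ φ) 2 volume = ‖p.2‖ₑ := by
  obtain ⟨φ, hval, hgrad⟩ := hp
  exact ⟨φ, φ.contDiff.of_le (by simp), φ.hasCompactSupport, φ.tsupport_subset, hval,
    eLpNorm_fderiv_eq_enorm φ.tsupport_subset hgrad⟩

theorem exists_eLpNorm_val_six_le [NeZero N] (hN : N ≤ 3) (Ω : BoundedDomain N) :
    ∃ C : ℝ≥0, ∀ u : Ω.H01, eLpNorm (H01.val u) 6 Ω.measure ≤ C * ‖H01.grad u‖ₑ := by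
  obtain ⟨C, hC⟩ := exists_eLpNorm_six_le_eLpNorm_fderiv_two hN Ω.isBounded
  refine ⟨C, fun u => closure_minimal (fun p hp => ?_)
    (isClosed_setOf_eLpNorm_fst_le ENNReal.coe_ne_top) u.2⟩
  obtain ⟨φ, hφ, hc, hsub, hval, hgrad⟩ := exists_contDiff_of_mem_testPairs hp
  rw [mem_ofPred_eq, eLpNorm_congr_ae hval,
    eLpNorm_restrict_eq_of_support_subset ((subset_tsupport φ).trans hsub), ← hgrad]
  exact hC φ hφ hc hsub

/-- The continuous linear functional on `L²(Ω)` averaging over the ball `B(y, δ)` the extension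
of a function by zero outside `Ω`. -/
def ballAverage (Ω : BoundedDomain N) (δ : ℝ) (y : EuclideanSpace ℝ (Fin N)) :
    Lp ℝ 2 Ω.measure →L[ℝ] ℝ :=
  (volume.real (Metric.ball y δ))⁻¹ •
    innerSL ℝ (indicatorConstLp 2 (measurableSet_ball (x := y) (ε := δ))
      (measure_ne_top Ω.measure _) 1)

theorem ballAverage_eq_setAverage {δ : ℝ} {y : EuclideanSpace ℝ (Fin N)} {f : Lp ℝ 2 Ω.measure}
    {φ : EuclideanSpace ℝ (Fin N) → ℝ} (hφ : φ.support ⊆ Ω.carrier) (hf : f =ᵐ[Ω.measure] φ) :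
    Ω.ballAverage δ y f = ⨍ z in Metric.ball y δ, φ z := by
  have hint : ∫ z in Metric.ball y δ, f z ∂Ω.measure = ∫ z in Metric.ball y δ, φ z := by
    rw [integral_congr_ae (ae_restrict_of_ae hf), Measure.restrict_restrict measurableSet_ball]
    exact (setIntegral_eq_of_subset_of_forall_sdiff_eq_zero measurableSet_ball inter_subset_left
      fun z hz => by_contra fun h => hz.2 ⟨hz.1, hφ h⟩).symm
  rw [ballAverage, setAverage_eq, ← hint, ← L2.inner_indicatorConstLp_one measurableSet_ball
    (measure_ne_top Ω.measure _)]
  rfl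

theorem exists_isCompactOperator_norm_val_sub_sq_le (Ω : BoundedDomain N) {δ : ℝ} (hδ : 0 < δ) :
    ∃ A : Lp ℝ 2 Ω.measure →L[ℝ] Lp ℝ 2 Ω.measure, IsCompactOperator A ∧
      ∀ u : Ω.H01, ‖H01.val u - A (H01.val u)‖ ^ 2 ≤ 2 ^ N * (2 * δ) ^ 2 * ‖H01.grad u‖ ^ 2 := by
  obtain ⟨π, hπ⟩ := exists_simpleFunc_dist_lt
    (Ω.isBounded.isCompact_closure.totallyBounded.subset subset_closure) hδ
  obtain ⟨A, hA, hAπ⟩ := exists_isCompactOperator_ae_eq_comp_simpleFunc (μ := Ω.measure) 2 π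
    (Ω.ballAverage δ)
  suffices (Ω.testPairs : Set Ω.L2Pair) ⊆
      {p | ‖p.1 - A p.1‖ ^ 2 ≤ 2 ^ N * (2 * δ) ^ 2 * ‖p.2‖ ^ 2} from
    ⟨A, hA, fun u => closure_minimal this (isClosed_le (by fun_prop) (by fun_prop)) u.2⟩
  intro p hp
  obtain ⟨φ, hφ, -, hsub, hval, hgrad⟩ := exists_contDiff_of_mem_testPairs hp
  have hsupp : φ.support ⊆ Ω.carrier := (subset_tsupport φ).trans hsub
  have hdiff : (p.1 - A p.1 : Lp ℝ 2 Ω.measure) =ᵐ[Ω.measure]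
      fun x => φ x - ⨍ z in Metric.ball (π x) δ, φ z := by
    filter_upwards [Lp.coeFn_sub p.1 (A p.1), hval, hAπ p.1] with x hx hφx hAx
    rw [hx, Pi.sub_apply, hφx, hAx, ballAverage_eq_setAverage hsupp hval]
  have hle : ‖p.1 - A p.1‖ₑ ^ 2 ≤ ENNReal.ofReal (2 ^ N * (2 * δ) ^ 2) * ‖p.2‖ₑ ^ 2 := by
    rw [← hgrad, Lp.enorm_def, eLpNorm_congr_ae hdiff, eLpNorm_ofNat_pow, eLpNorm_ofNat_pow]
    exact (setLIntegral_enorm_sub_setAverage_ball_sq_le (μ := volume) hφ hδ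
      Ω.isOpen.measurableSet hπ).trans_eq (by rw [finrank_euclideanSpace_fin])
  simpa [ENNReal.toReal_ofReal, hδ.le] using ENNReal.toReal_mono (by finiteness) hle

theorem isCompactOperator_val (Ω : BoundedDomain N) :
    IsCompactOperator ((ContinuousLinearMap.fst ℝ _ _).comp Ω.H01.subtypeL) := by
  set V := (ContinuousLinearMap.fst ℝ (Lp ℝ 2 Ω.measure)
    (Lp (EuclideanSpace ℝ (Fin N)) 2 Ω.measure)).comp Ω.H01.subtypeL
  refine isClosed_setOfPred_isCompactOperator.closure_subset <|
    Metric.mem_closure_iff.2 fun ε hε => ?_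
  obtain ⟨A, hA, hAV⟩ := exists_isCompactOperator_norm_val_sub_sq_le Ω
    (δ := ε / (2 ^ N * 4)) (by positivity)
  refine ⟨A.comp V, hA.comp_clm V, ?_⟩
  have hle (u : Ω.H01) : ‖(V - A.comp V) u‖ ≤ ε / 2 * ‖u‖ := by
    refine (pow_le_pow_iff_left₀ (by positivity) (by positivity) two_ne_zero).1 ?_
    calc ‖(V - A.comp V) u‖ ^ 2
        ≤ 2 ^ N * (2 * (ε / (2 ^ N * 4))) ^ 2 * ‖H01.grad u‖ ^ 2 := hAV u
      _ ≤ (2 ^ N) ^ 2 * (2 * (ε / (2 ^ N * 4))) ^ 2 * ‖u‖ ^ 2 := by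
          gcongr
          · exact le_self_pow₀ (one_le_pow₀ one_le_two) two_ne_zero
          · exact norm_snd_le (u : Ω.L2Pair)
      _ = (ε / 2 * ‖u‖) ^ 2 := by field_simp; ring
  rw [dist_eq_norm]
  exact (ContinuousLinearMap.opNorm_le_bound _ (by positivity) hle).trans_lt (half_lt_self hε)

end BoundedDomain

section Copositive

variable {ι : Type*} [Fintype ι] {g : Matrix ι ι ℝ}

/-- Strict copositivity of a matrix: its quadratic form is positive at the nonzero vectors of the
nonnegative orthant. It is what the two alternatives for the coupling matrix have in common. -/
def IsStrictlyCopositive (g : Matrix ι ι ℝ) : Prop :=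
  ∀ x : ι → ℝ, 0 ≤ x → x ≠ 0 → 0 < ∑ i, ∑ j, g i j * x i * x j

theorem isStrictlyCopositive_of_forall_pos (hg : ∀ i j, 0 < g i j) : IsStrictlyCopositive g := by
  intro x hx hx0
  obtain ⟨k, hk⟩ := Function.ne_iff.1 hx0
  have hterm (i j : ι) : 0 ≤ g i j * x i * x j := mul_nonneg (mul_nonneg (hg i j).le (hx i)) (hx j)
  have hxk : 0 < x k := (hx k).lt_of_ne' hk
  have hkk : 0 < g k k * x k * x k := by have := hg k k; positivity
  refine Finset.sum_pos' (fun i _ => Finset.sum_nonneg fun j _ => hterm i j)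
    ⟨k, Finset.mem_univ k, ?_⟩
  exact Finset.sum_pos' (fun j _ => hterm k j) ⟨k, Finset.mem_univ k, hkk⟩

theorem isStrictlyCopositive_of_posDef (hg : g.PosDef) : IsStrictlyCopositive g := by
  intro x _ hx0
  refine (hg.dotProduct_mulVec_pos hx0).trans_eq ?_
  simp only [dotProduct, Matrix.mulVec, Finset.mul_sum, Pi.star_apply, star_trivial]
  exact Finset.sum_congr rfl fun i _ => Finset.sum_congr rfl fun j _ => by ring

theorem IsStrictlyCopositive.exists_mul_sq_norm_le (hg : IsStrictlyCopositive g) :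
    ∃ c > 0, ∀ x : ι → ℝ, 0 ≤ x → c * ‖x‖ ^ 2 ≤ ∑ i, ∑ j, g i j * x i * x j := by
  obtain ⟨c, hc, hle⟩ := ((isCompact_sphere (0 : ι → ℝ) 1).inter_right
    (isClosed_Ici (a := 0))).exists_forall_le'
    (f := fun x => ∑ i, ∑ j, g i j * x i * x j) (by fun_prop) (a := 0)
    fun x hx => hg x hx.2 (ne_zero_of_mem_unit_sphere ⟨x, hx.1⟩)
  refine ⟨c, hc, fun x hx => ?_⟩
  rcases eq_or_ne x 0 with rfl | hx0
  · simp
  have hnorm : 0 < ‖x‖ := norm_pos_iff.2 hx0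
  have hunit := hle (‖x‖⁻¹ • x)
    ⟨by simp [norm_smul, hnorm.ne'], smul_nonneg (inv_nonneg.2 hnorm.le) hx⟩
  have hscale : ∑ i, ∑ j, g i j * (‖x‖⁻¹ • x) i * (‖x‖⁻¹ • x) j =
      (∑ i, ∑ j, g i j * x i * x j) / ‖x‖ ^ 2 := by
    simp only [Finset.sum_div, Pi.smul_apply, smul_eq_mul]
    exact Finset.sum_congr rfl fun i _ => Finset.sum_congr rfl fun j _ => by field_simp
  rwa [hscale, le_div_iff₀ (by positivity)] at hunit

end Copositive

section LpFour

variable {α ι : Type*} [MeasurableSpace α] {μ : Measure α} [Fintype ι]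

instance fact_one_le_four : Fact ((1 : ℝ≥0∞) ≤ 4) := ⟨by norm_num⟩

instance holderTriple_four_four_two : ENNReal.HolderTriple 4 4 2 where
  inv_add_inv_eq_inv := by
    rw [show (4 : ℝ≥0∞) = 2 * 2 by norm_num, ENNReal.mul_inv (by simp) (by simp), ← add_mul,
      ENNReal.inv_two_add_inv_two, one_mul]

variable (μ) in
/-- Multiplication `L⁴ × L⁴ → L²`. -/
def mulFour : Lp ℝ 4 μ →L[ℝ] Lp ℝ 4 μ →L[ℝ] Lp ℝ 2 μ :=
  (ContinuousLinearMap.mul ℝ ℝ).holderL μ 4 4 2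

theorem coeFn_mulFour (x y : Lp ℝ 4 μ) : mulFour μ x y =ᵐ[μ] fun t => x t * y t :=
  (ContinuousLinearMap.mul ℝ ℝ).coeFn_holder x y

theorem norm_mulFour_self (x : Lp ℝ 4 μ) : ‖mulFour μ x x‖ = ‖x‖ ^ 2 := by
  have h : ‖mulFour μ x x‖ₑ ^ 2 = (‖x‖ₑ ^ 2) ^ 2 := by
    rw [← pow_mul, Lp.enorm_def, Lp.enorm_def, eLpNorm_congr_ae (coeFn_mulFour x x),
      eLpNorm_ofNat_pow, eLpNorm_ofNat_pow]
    exact lintegral_congr fun t => by rw [enorm_mul]; ring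
  simpa using congrArg ENNReal.toReal ((ENNReal.pow_right_strictMono two_ne_zero).injective h)

theorem coeFn_inner_mulFour_self (x y : Lp ℝ 4 μ) :
    (fun t => inner ℝ (mulFour μ x x t) (mulFour μ y y t)) =ᵐ[μ] fun t => x t ^ 2 * y t ^ 2 := by
  filter_upwards [coeFn_mulFour x x, coeFn_mulFour y y] with t hx hy
  rw [hx, hy, RCLike.inner_apply, conj_trivial]
  ring

theorem integrable_sq_mul_sq (x y : Lp ℝ 4 μ) : Integrable (fun t => x t ^ 2 * y t ^ 2) μ :=
  (L2.integrable_inner _ _).congr (coeFn_inner_mulFour_self x y)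

theorem inner_mulFour_self (x y : Lp ℝ 4 μ) :
    inner ℝ (mulFour μ x x) (mulFour μ y y) = ∫ t, x t ^ 2 * y t ^ 2 ∂μ := by
  rw [L2.inner_def, integral_congr_ae (coeFn_inner_mulFour_self x y)]

theorem norm_pow_four_eq_integral (x : Lp ℝ 4 μ) : ‖x‖ ^ 4 = ∫ t, x t ^ 4 ∂μ := by
  calc ‖x‖ ^ 4 = inner ℝ (mulFour μ x x) (mulFour μ x x) := by
        rw [real_inner_self_eq_norm_sq, norm_mulFour_self, ← pow_mul]
    _ = ∫ t, x t ^ 4 ∂μ := by simp only [inner_mulFour_self, ← pow_add]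

variable (μ) in
/-- The bilinear form `(x, y) ↦ ∑ᵢ ∫ aᵢ xᵢ yᵢ` on `L⁴`. -/
def potentialForm (a : ι → Lp ℝ 2 μ) : (ι → Lp ℝ 4 μ) →L[ℝ] (ι → Lp ℝ 4 μ) →L[ℝ] ℝ :=
  ∑ i, ((ContinuousLinearMap.compL ℝ (Lp ℝ 4 μ) (Lp ℝ 2 μ) ℝ (innerSL ℝ (a i))).comp
    (mulFour μ)).bilinearComp (ContinuousLinearMap.proj i) (ContinuousLinearMap.proj i)

theorem potentialForm_apply (a : ι → Lp ℝ 2 μ) (x y : ι → Lp ℝ 4 μ) :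
    potentialForm μ a x y = ∑ i, inner ℝ (a i) (mulFour μ (x i) (y i)) := by
  simp [potentialForm]

/-- The quartic form `x ↦ ∑ᵢⱼ gᵢⱼ ∫ xᵢ² xⱼ²` on `L⁴`. -/
def quarticForm (g : Matrix ι ι ℝ) (x : ι → Lp ℝ 4 μ) : ℝ :=
  ∑ i, ∑ j, g i j * inner ℝ (mulFour μ (x i) (x i)) (mulFour μ (x j) (x j))

variable {g : Matrix ι ι ℝ}

theorem contDiff_quarticForm : ContDiff ℝ 1 (quarticForm (μ := μ) g) := by
  have hsq (i : ι) : ContDiff ℝ 1 fun x : ι → Lp ℝ 4 μ => mulFour μ (x i) (x i) :=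
    (mulFour μ).isBoundedBilinearMap.contDiff.comp
      ((contDiff_apply ℝ _ i).prodMk (contDiff_apply ℝ _ i))
  exact ContDiff.sum fun i _ => ContDiff.sum fun j _ => contDiff_const.mul ((hsq i).inner ℝ (hsq j))

theorem quarticForm_smul (t : ℝ) (x : ι → Lp ℝ 4 μ) :
    quarticForm g (t • x) = t ^ 4 * quarticForm g x := by
  simp only [quarticForm, Pi.smul_apply, map_smul, smul_apply, real_inner_smul_left,
    real_inner_smul_right, Finset.mul_sum]
  exact Finset.sum_congr rfl fun i _ => Finset.sum_congr rfl fun j _ => by ring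

theorem integrable_quarticForm_integrand (x : ι → Lp ℝ 4 μ) :
    Integrable (fun t => ∑ i, ∑ j, g i j * x i t ^ 2 * x j t ^ 2) μ := by
  simp only [mul_assoc]
  exact integrable_finsetSum _ fun i _ => integrable_finsetSum _ fun j _ =>
    (integrable_sq_mul_sq (x i) (x j)).const_mul (g i j)

theorem quarticForm_eq_integral (x : ι → Lp ℝ 4 μ) :
    quarticForm g x = ∫ t, ∑ i, ∑ j, g i j * x i t ^ 2 * x j t ^ 2 ∂μ := by
  have hint (i j : ι) : Integrable (fun t => g i j * (x i t ^ 2 * x j t ^ 2)) μ :=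
    (integrable_sq_mul_sq (x i) (x j)).const_mul (g i j)
  simp only [quarticForm, inner_mulFour_self, mul_assoc]
  rw [integral_finsetSum _ fun i _ => integrable_finsetSum _ fun j _ => hint i j]
  simp only [integral_finsetSum _ fun j _ => hint _ j, integral_const_mul]

theorem IsStrictlyCopositive.exists_mul_norm_pow_four_le (hg : IsStrictlyCopositive g)
    (μ : Measure α) : ∃ c > 0, ∀ x : ι → Lp ℝ 4 μ, c * ‖x‖ ^ 4 ≤ quarticForm g x := by
  obtain ⟨c, hc, hle⟩ := hg.exists_mul_sq_norm_le
  have hcomp (x : ι → Lp ℝ 4 μ) (i : ι) : c * ‖x i‖ ^ 4 ≤ quarticForm g x := by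
    rw [norm_pow_four_eq_integral, ← integral_const_mul, quarticForm_eq_integral]
    refine integral_mono ?_ (integrable_quarticForm_integrand x) fun t => ?_
    · simpa only [← pow_add] using (integrable_sq_mul_sq (x i) (x i)).const_mul c
    · calc c * x i t ^ 4 = c * ‖x i t ^ 2‖ ^ 2 := by rw [Real.norm_eq_abs, sq_abs, ← pow_mul]
        _ ≤ c * ‖fun j => x j t ^ 2‖ ^ 2 := by
            gcongr
            exact norm_le_pi_norm (fun j => x j t ^ 2) i
        _ ≤ ∑ i, ∑ j, g i j * x i t ^ 2 * x j t ^ 2 := hle _ fun j => sq_nonneg (x j t)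
  refine ⟨c, hc, fun x => ?_⟩
  rcases isEmpty_or_nonempty ι with hι | hι
  · simp [quarticForm, Subsingleton.elim x 0]
  · obtain ⟨i, hi⟩ := Finite.exists_max fun i => ‖x i‖
    have hx : ‖x‖ ≤ ‖x i‖ := (pi_norm_le_iff_of_nonneg (norm_nonneg _)).2 hi
    exact le_trans (by gcongr) (hcomp x i)

end LpFour

namespace BoundedDomain

open scoped NNReal

variable {N : ℕ} [NeZero N]

theorem exists_memLp_four_val (hN : N ≤ 3) (Ω : BoundedDomain N) :
    ∃ C : ℝ≥0, ∀ u : Ω.H01, MemLp (H01.val u) 4 Ω.measure ∧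
      eLpNorm (H01.val u) 4 Ω.measure ^ 4 ≤ ‖H01.val u‖ₑ * (C * ‖u‖ₑ) ^ 3 := by
  obtain ⟨C, hC⟩ := exists_eLpNorm_val_six_le hN Ω
  refine ⟨C, fun u => ?_⟩
  have hu : AEStronglyMeasurable (H01.val u) Ω.measure := Lp.aestronglyMeasurable _
  have hsix : eLpNorm (H01.val u) 6 Ω.measure ≤ C * ‖u‖ₑ :=
    (hC u).trans (by gcongr; exact enorm_le_iff_norm_le.2 (norm_snd_le (u : Ω.L2Pair)))
  have hmem : MemLp (H01.val u) 6 Ω.measure := ⟨hu, hsix.trans_lt (by finiteness)⟩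
  refine ⟨hmem.mono_exponent (by norm_num), (eLpNorm_four_pow_four_le hu).trans ?_⟩
  rw [Lp.enorm_def]
  gcongr

theorem exists_embedding_four (hN : N ≤ 3) (Ω : BoundedDomain N) :
    ∃ (T : Ω.H01 →L[ℝ] Lp ℝ 4 Ω.measure) (C : ℝ≥0), (∀ u, T u =ᵐ[Ω.measure] H01.val u) ∧
      ∀ u, ‖T u‖ ^ 4 ≤ ‖H01.val u‖ * (C * ‖u‖) ^ 3 := by
  obtain ⟨C, hC⟩ := exists_memLp_four_val hN Ω
  let T : Ω.H01 →ₗ[ℝ] Lp ℝ 4 Ω.measure :=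
    { toFun := fun u => (hC u).1.toLp
      map_add' := fun u v => by
        rw [← MemLp.toLp_add]
        exact MemLp.toLp_congr _ _ (Lp.coeFn_add _ _)
      map_smul' := fun t u => by
        rw [RingHom.id_apply, ← MemLp.toLp_const_smul]
        exact MemLp.toLp_congr _ _ (Lp.coeFn_smul _ _) }
  have hT (u : Ω.H01) : T u =ᵐ[Ω.measure] H01.val u := (hC u).1.coeFn_toLp
  have hpow (u : Ω.H01) : ‖T u‖ ^ 4 ≤ ‖H01.val u‖ * (C * ‖u‖) ^ 3 := by
    have h := (hC u).2
    rw [← eLpNorm_congr_ae (hT u), ← Lp.enorm_def] at h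
    simpa using ENNReal.toReal_mono (by finiteness) h
  have hbound (u : Ω.H01) : ‖T u‖ ≤ (C + 1) * ‖u‖ := by
    refine le_of_pow_le_pow_left₀ four_ne_zero (by positivity) ((hpow u).trans ?_)
    have hval : ‖H01.val u‖ ≤ ‖u‖ := norm_fst_le (u : Ω.L2Pair)
    calc ‖H01.val u‖ * (C * ‖u‖) ^ 3 ≤ ((C + 1) * ‖u‖) * ((C + 1) * ‖u‖) ^ 3 := by
          gcongr
          · exact hval.trans (le_mul_of_one_le_left (norm_nonneg _) (by simp))
          · simp
      _ = ((C + 1) * ‖u‖) ^ 4 := by ring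
  exact ⟨T.mkContinuous (C + 1) hbound, C, hT, hpow⟩

theorem exists_compact_embedding_four (hN : N ≤ 3) (Ω : BoundedDomain N) :
    ∃ T : Ω.H01 →L[ℝ] Lp ℝ 4 Ω.measure,
      (∀ u, T u =ᵐ[Ω.measure] H01.val u) ∧ IsCompactOperator T := by
  obtain ⟨T, C, hT, hpow⟩ := exists_embedding_four hN Ω
  exact ⟨T, hT, isCompactOperator_of_norm_pow_succ_le (isCompactOperator_val Ω) hpow⟩

end BoundedDomain

namespace SystemSpace

variable {N m : ℕ} {Ω : BoundedDomain N} {ε : Fin m → Ioi (0 : ℝ)}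

theorem integral_quartic_eq {g : Matrix (Fin m) (Fin m) ℝ} {u : SystemSpace Ω ε}
    {y : Fin m → Lp ℝ 4 Ω.measure} (hy : ∀ i, y i =ᵐ[Ω.measure] u.comp i) :
    ∫ x, ∑ i, ∑ j, g i j * |u.comp i x| ^ 2 * |u.comp j x| ^ 2 ∂Ω.measure =
      quarticForm g y := by
  rw [quarticForm_eq_integral]
  refine integral_congr_ae ?_
  filter_upwards [ae_all_iff.2 hy] with x hx
  simp only [hx, sq_abs]

variable [NeZero N]

theorem exists_compact_embedding_four (hN : N ≤ 3) (Ω : BoundedDomain N)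
    (ε : Fin m → Ioi (0 : ℝ)) :
    ∃ J : SystemSpace Ω ε →L[ℝ] (Fin m → Lp ℝ 4 Ω.measure),
      (∀ u i, J u i =ᵐ[Ω.measure] u.comp i) ∧ IsCompactOperator J := by
  obtain ⟨e, he⟩ := exists_equiv_prod Ω ε
  obtain ⟨T, hT, hTc⟩ := BoundedDomain.exists_compact_embedding_four hN Ω
  refine ⟨ContinuousLinearMap.pi fun i => T.comp ((ContinuousLinearMap.proj i).comp
    (e : SystemSpace Ω ε →L[ℝ] (Fin m → Ω.H01))), fun u i => ?_,
    isCompactOperator_pi fun i => hTc.comp_clm _⟩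
  have h : T (e u i) = T (u i) := congrArg T (he u i)
  change T (e u i) =ᵐ[Ω.measure] BoundedDomain.H01.val (u i)
  exact h ▸ hT (u i)

section Energy

variable {a : Fin m → EuclideanSpace ℝ (Fin N) → ℝ} {g : Matrix (Fin m) (Fin m) ℝ}
  {a' : Fin m → Lp ℝ 2 Ω.measure} {u : SystemSpace Ω ε} {y : Fin m → Lp ℝ 4 Ω.measure}

theorem integral_quadratic_eq (ha : ∀ i, a' i =ᵐ[Ω.measure] a i)
    (hy : ∀ i, y i =ᵐ[Ω.measure] u.comp i) :
    ∫ x, ∑ i, ((ε i : ℝ) * ‖u.grad i x‖ ^ 2 + a i x * |u.comp i x| ^ 2) ∂Ω.measure =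
      ‖u‖ ^ 2 + potentialForm Ω.measure a' y y := by
  have hgrad (i : Fin m) :
      Integrable (fun x => (ε i : ℝ) * inner ℝ (u.grad i x) (u.grad i x)) Ω.measure :=
    (L2.integrable_inner _ _).const_mul _
  have hpot (i : Fin m) :
      Integrable (fun x => inner ℝ (a' i x) (mulFour Ω.measure (y i) (y i) x)) Ω.measure :=
    L2.integrable_inner _ _
  have hpoint : (fun x => ∑ i, ((ε i : ℝ) * ‖u.grad i x‖ ^ 2 + a i x * |u.comp i x| ^ 2))
      =ᵐ[Ω.measure] fun x => ∑ i, ((ε i : ℝ) * inner ℝ (u.grad i x) (u.grad i x) +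
        inner ℝ (a' i x) (mulFour Ω.measure (y i) (y i) x)) := by
    filter_upwards [ae_all_iff.2 ha, ae_all_iff.2 hy,
      ae_all_iff.2 fun i => coeFn_mulFour (y i) (y i)] with x hax hyx hmul
    refine Finset.sum_congr rfl fun i _ => ?_
    rw [hmul, hax, hyx, real_inner_self_eq_norm_sq, RCLike.inner_apply, conj_trivial, sq_abs]
    ring
  rw [integral_congr_ae hpoint, integral_finsetSum _ fun i _ => (hgrad i).fun_add (hpot i),
    norm_sq_eq, potentialForm_apply, ← Finset.sum_add_distrib]
  refine Finset.sum_congr rfl fun i _ => ?_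
  rw [integral_add (hgrad i) (hpot i), integral_const_mul, ← L2.inner_def, ← L2.inner_def,
    real_inner_self_eq_norm_sq]

theorem energy_eq_homogeneousEnergy (ha : ∀ i, a' i =ᵐ[Ω.measure] a i)
    {J : SystemSpace Ω ε →L[ℝ] (Fin m → Lp ℝ 4 Ω.measure)}
    (hJ : ∀ u i, J u i =ᵐ[Ω.measure] u.comp i) :
    energy a g =
      homogeneousEnergy J (potentialForm Ω.measure a') (quarticForm g) (1 / (4 : ℝ)) := by
  funext u
  rw [energy, homogeneousEnergy, integral_quadratic_eq ha (hJ u), integral_quartic_eq (hJ u)]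

end Energy

end SystemSpace

end

theorem lemma2p4_general {N m : ℕ} [NeZero N] (hN : N ≤ 3) (Ω : BoundedDomain N)
    (ε : Fin m → Set.Ioi (0 : ℝ)) (g : Matrix (Fin m) (Fin m) ℝ) (hg : IsStrictlyCopositive g)
    (a : Fin m → EuclideanSpace ℝ (Fin N) → ℝ) (ha : ∀ i, MemLp (a i) 2 Ω.measure)
    (E : SystemSpace Ω ε → ℝ) (hE : E = SystemSpace.energy a g)
    (u : ℕ → SystemSpace Ω ε) (hu : ∀ n, SystemSpace.nehariFunctional E (u n) = 0)
    (hbdd : ∃ C : ℝ, ∀ n, E (u n) ≤ C)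
    (hgrad : Tendsto (fun n => ‖SystemSpace.riemannianGradient E (u n)‖) atTop (𝓝 0)) :
    ∃ (v : SystemSpace Ω ε) (φ : ℕ → ℕ), StrictMono φ ∧ Tendsto (u ∘ φ) atTop (𝓝 v) := by
  obtain ⟨J, hJ, hJc⟩ := SystemSpace.exists_compact_embedding_four hN Ω ε
  obtain ⟨c, hc, hcoer⟩ := hg.exists_mul_norm_pow_four_le Ω.measure
  obtain ⟨C, hC⟩ := hbdd
  obtain rfl := hE.trans
    (SystemSpace.energy_eq_homogeneousEnergy (fun i => (ha i).coeFn_toLp) hJ)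
  refine exists_tendsto_subseq_of_nehari (p := 4)
    (r := fun n => SystemSpace.riemannianGradient _ (u n)) contDiff_quarticForm
    (fun t _ x => ?_) (by norm_num) hc (fun x => ?_) hJc hu hC
    (fun n ξ hξ => SystemSpace.inner_riemannianGradient _ (u n) ξ hξ) hgrad
  · rw [quarticForm_smul, Real.rpow_ofNat]
  · simpa only [Real.rpow_ofNat] using hcoer x

theorem lemma2p4 {N m : ℕ} [NeZero N] (hN : N ≤ 3) (Ω : BoundedDomain N)
    (ε : Fin m → Set.Ioi (0 : ℝ))
    (g : Matrix (Fin m) (Fin m) ℝ) (hsymm : g.IsSymm)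
    (hg : (∀ i j, 0 < g i j) ∨ g.PosDef)
    (a : Fin m → EuclideanSpace ℝ (Fin N) → ℝ)
    (ha : ∀ i, MemLp (a i) ∞ Ω.measure)
    (ha_lower : ∀ i, ∀ᵐ x ∂Ω.measure, -Ω.firstDirichletEigenvalue < a i x)
    (E : SystemSpace Ω ε → ℝ) (hE : E = SystemSpace.energy a g)
    (u : ℕ → SystemSpace Ω ε) (hu : ∀ n, u n ∈ SystemSpace.nehariManifold E)
    (hbdd : ∃ C : ℝ, ∀ n, |E (u n)| ≤ C)
    (hgrad : Tendsto (fun n => ‖SystemSpace.riemannianGradient E (u n)‖) atTop (𝓝 0)) :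
    ∃ (v : SystemSpace Ω ε) (φ : ℕ → ℕ), StrictMono φ ∧ Tendsto (u ∘ φ) atTop (𝓝 v) :=
  lemma2p4_general hN Ω ε g
    (hg.elim isStrictlyCopositive_of_forall_pos isStrictlyCopositive_of_posDef) a
    (fun i => (ha i).mono_exponent le_top) E hE u (fun n => (hu n).2)
    (hbdd.imp fun _ hC n => (le_abs_self _).trans (hC n)) hgrad
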